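/- Let $N,H\ge 1$ be integers, let $(\mathsf Z,\mathcal Z)$ be a measurable space and, for $c\in\{1,\dots,N\}$, let $\nu_c$ be a probability measure on $\mathsf Z$ and $F_c^z:\mathbb R^d\to\mathbb R$ ($z\in\mathsf Z$) functions such that $z\mapsto F_c^z(\theta)$ is measurable and $\nu_c$-integrable for every $\theta$. Put $f_c(\theta)=\int F_c^z(\theta)\,\nu_c(\mathrm dz)$ and $f=\frac1N\sum_{c=1}^N f_c$, and let $\theta^\star\in\arg\min f$. Let $\mu,L>0$ and assume: * (strong convexity) every $f_c$ is twice differentiable and $\mu$-strongly convex; * (smoothness) every $F_c^z$ is convex, twice differentiable and $L$-smooth, i.e. $\|\nabla F_c^z(\theta)-\nabla F_c^z(\theta')\|\le L\|\theta-\theta'\|$ for all $\theta,\theta'$; * (noise) there are $\sigma_\star^2,\beta\ge0$ such that, for all $\theta\in\mathbb R^d$, $p\in\{1,2,3\}$ and $c$, $\big(\int\|\nabla F_c^z(\theta)-\nabla f_c(\theta)\|^{2p}\,\nu_c(\mathrm dz)\big)^{1/p}\le\sigma_\star^2+\beta\|\theta-\theta^\star\|^2$. Let $\gamma>0$ satisfy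 $\gamma\le 1/(2L)$ and $\gamma H(L+\mu)\le 1$. Let $\mathcal X=\{X=(\theta,\xi_1,\dots,\xi_N)\in(\mathbb R^d)^{N+1}:\sum_{c=1}^N\xi_c=0\}$, with the norm $\|X\|_\Lambda^2=\|\theta\|^2+\frac{\gamma^2H^2}{N}\sum_{c=1}^N\|\xi_c\|^2$, and let $\mathbf W_2^2(\rho_1,\rho_2)=\inf_\xi\int\|X-X'\|_\Lambda^2\,\xi(\mathrm dX,\mathrm dX')$, the infimum being over all couplings $\xi$ of the probability measures $\rho_1,\rho_2$ on $\mathcal X$. The SCAFFOLD iterates $X^t=(\theta^t,\xi_1^t,\dots,\xi_N^t)$ start at a random $X^0$ with law $\rho$ on $\mathcal X$. In round $t$, each client sets $\theta_c^{t,0}=\theta^t$ and $\theta_c^{t,h+1}=\theta_c^{t,h}-\gamma\big(\nabla F_c^{Z_c^{t,h+1}}(\theta_c^{t,h})+\xi_c^t\big)$ for $0\le h<H$; then $\theta^{t+1}=\frac1N\sum_{c=1}^N\theta_c^{t,H}$ and $\xi_c^{t+1}=\xi_c^t+\frac1{\gamma H}(\theta_c^{t,H}-\theta^{t+1})$. The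 $Z_c^{t,h}\sim\nu_c$ are independent, and jointly independent of $X^0$. Then $(X^t)_{t\ge0}$ is a time-homogeneous Markov chain on $\mathcal X$, whose Markov kernel $K$ does not depend on $\rho$, and $X^t$ has law $\rho K^t$. The kernel $K$ has a unique stationary probability measure $\pi^{(\gamma,H)}$, and $\int\|X\|_\Lambda^2\,\pi^{(\gamma,H)}(\mathrm dX)<\infty$. For every probability measure $\rho$ on $\mathcal X$ with $\int\|X\|_\Lambda^2\,\rho(\mathrm dX)<\infty$, every $\rho K^t$ has a finite second moment, $\mathbf W_2(\rho K^t,\pi^{(\gamma,H)})\to0$ as $t\to\infty$, and for every $t\in\mathbb N$ $$\mathbf W_2^2\big(\rho K^t,\pi^{(\gamma,H)}\big)\le\Big(1-\frac{\gamma\mu}{4}\Big)^{Ht}\,\mathbf W_2^2\big(\rho,\pi^{(\gamma,H)}\big)<\infty .$$ -/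

import Mathlib

open MeasureTheory ProbabilityTheory Filter Topology
open scoped ENNReal

namespace Scaffold

/-- The parameter space `ℝ^d` with its Euclidean norm. -/
abbrev Param (d : ℕ) : Type := EuclideanSpace ℝ (Fin d)

/-- The state space `𝒳`: a global parameter `X.1` and control variates `X.2 c` (one for each
client) that sum to zero. It carries the topology and the Borel `σ`-algebra of `ℝ^((N+1)d)`. -/
abbrev State (N d : ℕ) : Type :=
  {X : Param d × (Fin N → Param d) // ∑ c, X.2 c = 0}

section Algorithm

variable {Z : Type*} {d N : ℕ}

/-- The local iterate of a client after `h` stochastic gradient steps with step size `γ`, started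
at `θ`, corrected by the control variate `ξ`, with the observations `z 0, …, z (h-1)`. -/
noncomputable def localIterate (F : Z → Param d → ℝ) (γ : ℝ) (θ ξ : Param d) :
    (h : ℕ) → (Fin h → Z) → Param d
  | 0, _ => θ
  | h + 1, z =>
    localIterate F γ θ ξ h (fun i => z i.castSucc)
      - γ • (gradient (F (z (Fin.last h))) (localIterate F γ θ ξ h (fun i => z i.castSucc)) + ξ)

/-- The new global parameter: the average over the clients of the local iterates after `H` steps. -/
noncomputable def globalUpdate (F : Fin N → Z → Param d → ℝ) (γ : ℝ) (H : ℕ)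
    (X : Param d × (Fin N → Param d)) (z : Fin N → Fin H → Z) : Param d :=
  (1 / (N : ℝ)) • ∑ c, localIterate (F c) γ X.1 (X.2 c) H (z c)

/-- The new control variate of client `c`. -/
noncomputable def controlUpdate (F : Fin N → Z → Param d → ℝ) (γ : ℝ) (H : ℕ)
    (X : Param d × (Fin N → Param d)) (z : Fin N → Fin H → Z) (c : Fin N) : Param d :=
  X.2 c + (1 / (γ * H)) •
    (localIterate (F c) γ X.1 (X.2 c) H (z c) - globalUpdate F γ H X z)

theorem sum_controlUpdate (F : Fin N → Z → Param d → ℝ) (γ : ℝ) (H : ℕ)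
    (X : State N d) (z : Fin N → Fin H → Z) :
    ∑ c, controlUpdate F γ H X.1 z c = 0 := by
  rcases Nat.eq_zero_or_pos N with hN | hN
  · subst hN
    simp
  · have hN' : (N : ℝ) ≠ 0 := by positivity
    simp only [controlUpdate, Finset.sum_add_distrib, ← Finset.smul_sum, Finset.sum_sub_distrib,
      X.2, Finset.sum_const, Finset.card_univ, Fintype.card_fin, globalUpdate]
    rw [← Nat.cast_smul_eq_nsmul ℝ, smul_smul, one_div_mul_cancel hN', one_smul, sub_self,
      smul_zero, add_zero]

/-- One round of the algorithm, as a map of the state space into itself. -/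
noncomputable def update (F : Fin N → Z → Param d → ℝ) (γ : ℝ) (H : ℕ)
    (X : State N d) (z : Fin N → Fin H → Z) : State N d :=
  ⟨(globalUpdate F γ H X.1 z, controlUpdate F γ H X.1 z), sum_controlUpdate F γ H X z⟩

end Algorithm

section Norm

variable {d N : ℕ}

/-- The squared weighted norm `‖X‖_Λ² = ‖X_0‖² + (γ²H²/N) ∑_c ‖X_c‖²`. -/
noncomputable def lambdaNormSq (γ : ℝ) (H : ℕ) (X : Param d × (Fin N → Param d)) : ℝ :=
  ‖X.1‖ ^ 2 + γ ^ 2 * (H : ℝ) ^ 2 / (N : ℝ) * ∑ c, ‖X.2 c‖ ^ 2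

/-- The second moment `∫ ‖X‖_Λ² dρ`, as an element of `[0, ∞]`. -/
noncomputable def secondMoment (γ : ℝ) (H : ℕ) (ρ : Measure (State N d)) : ℝ≥0∞ :=
  ∫⁻ X, ENNReal.ofReal (lambdaNormSq γ H X.1) ∂ρ

/-- The squared 2-Wasserstein distance for the norm `‖·‖_Λ`: the infimum of the transport cost over
all couplings of `ρ₁` and `ρ₂`, as an element of `[0, ∞]`. -/
noncomputable def wassersteinSq (γ : ℝ) (H : ℕ) (ρ₁ ρ₂ : Measure (State N d)) : ℝ≥0∞ :=
  ⨅ (ξ : Measure (State N d × State N d)) (_ : ξ.map Prod.fst = ρ₁ ∧ ξ.map Prod.snd = ρ₂),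
    ∫⁻ p, ENNReal.ofReal (lambdaNormSq γ H (p.1.1 - p.2.1)) ∂ξ

end Norm

/-- Twice differentiable on all of `ℝ^d`. -/
def TwiceDifferentiable {d : ℕ} (f : Param d → ℝ) : Prop :=
  Differentiable ℝ f ∧ Differentiable ℝ (fderiv ℝ f)

/-- Every `F_c^z` is twice differentiable and `L`-smooth (its gradient is `L`-Lipschitz). -/
def Smoothness {Z : Type*} {d N : ℕ} (F : Fin N → Z → Param d → ℝ) (L : ℝ) : Prop :=
  ∀ c z, TwiceDifferentiable (F c z) ∧
    ∀ θ θ', ‖gradient (F c z) θ - gradient (F c z) θ'‖ ≤ L * ‖θ - θ'‖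

section Problem

variable {Z : Type*} [MeasurableSpace Z] {d N : ℕ}

/-- The local risk `f_c(θ) = 𝔼[F_c^Z(θ)]`, `Z ∼ ν`, of a client. -/
noncomputable def localRisk (F : Z → Param d → ℝ) (ν : Measure Z) (θ : Param d) : ℝ :=
  ∫ z, F z θ ∂ν

/-- The global risk `f = (1/N) ∑_c f_c`. -/
noncomputable def globalRisk (F : Fin N → Z → Param d → ℝ) (ν : Fin N → Measure Z)
    (θ : Param d) : ℝ :=
  (1 / (N : ℝ)) * ∑ c, localRisk (F c) (ν c) θ

/-- Every local risk is twice differentiable and `μ`-strongly convex. -/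
def StrongConvexity (F : Fin N → Z → Param d → ℝ) (ν : Fin N → Measure Z) (μ : ℝ) : Prop :=
  ∀ c, TwiceDifferentiable (localRisk (F c) (ν c)) ∧
    StrongConvexOn Set.univ μ (localRisk (F c) (ν c))

/-- The moment bound on the gradient noise `ε_c^z(θ) = ∇F_c^z(θ) - ∇f_c(θ)`. -/
def NoiseMomentBound (F : Fin N → Z → Param d → ℝ) (ν : Fin N → Measure Z)
    (θstar : Param d) : Prop :=
  ∃ σ β : ℝ, 0 ≤ σ ∧ 0 ≤ β ∧ ∀ (θ : Param d) (c : Fin N), ∀ p ∈ ({1, 2, 3} : Finset ℕ),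
    (∫⁻ z, ‖gradient (F c z) θ - gradient (localRisk (F c) (ν c)) θ‖ₑ ^ (2 * p) ∂(ν c))
        ^ (1 / (p : ℝ))
      ≤ ENNReal.ofReal (σ ^ 2 + β * ‖θ - θstar‖ ^ 2)

end Problem

section Chain

variable {Z : Type*} [MeasurableSpace Z] {d N : ℕ}

/-- The law of the observations of one round: independent over clients and over local steps, with
distribution `ν c` for client `c`. -/
noncomputable def noiseLaw (ν : Fin N → Measure Z) (H : ℕ) : Measure (Fin N → Fin H → Z) :=
  Measure.pi fun c => Measure.pi fun _ => ν c

/-- The law of the state after one round started at `X`. -/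
noncomputable def transition (F : Fin N → Z → Param d → ℝ) (ν : Fin N → Measure Z)
    (γ : ℝ) (H : ℕ) (X : State N d) : Measure (State N d) :=
  (noiseLaw ν H).map (update F γ H X)

/-- The process `X` consists of the iterates of the algorithm, started at `X 0 ∼ ρ`: all the
observations `ζ t c h` are independent with `ζ t c h ∼ ν c`, jointly independent of `X 0`, and the
round from `X t` to `X (t+1)` uses the observations `ζ t`. -/
structure IsIterates {Ω : Type*} [MeasurableSpace Ω] (P : Measure Ω)
    (F : Fin N → Z → Param d → ℝ) (ν : Fin N → Measure Z) (γ : ℝ) (H : ℕ)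
    (ρ : Measure (State N d)) (ζ : ℕ → Fin N → Fin H → Ω → Z) (X : ℕ → Ω → State N d) : Prop where
  measurable_obs : ∀ t c h, Measurable (ζ t c h)
  law_obs : ∀ t c h, P.map (ζ t c h) = ν c
  indep_obs : iIndepFun (fun i : ℕ × Fin N × Fin H => ζ i.1 i.2.1 i.2.2) P
  measurable_init : Measurable (X 0)
  law_init : P.map (X 0) = ρ
  indep_init : IndepFun (X 0) (fun ω (i : ℕ × Fin N × Fin H) => ζ i.1 i.2.1 i.2.2 ω) P
  step : ∀ t ω, X (t + 1) ω = update F γ H (X t ω) (fun c h => ζ t c h ω)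

end Chain

/-- The process `X` is a time-homogeneous Markov chain with transition kernel `K`: the conditional
law of `X (t+1)` given `X 0, …, X t` is `K (X t)`. -/
def IsMarkovChain {Ω S : Type*} [MeasurableSpace Ω] [MeasurableSpace S] (P : Measure Ω)
    (K : Kernel S S) (X : ℕ → Ω → S) : Prop :=
  (∀ t, Measurable (X t)) ∧
    ∀ (t : ℕ) (A : Set S), MeasurableSet A →
      P⟦X (t + 1) ⁻¹' A |
          MeasurableSpace.comap (fun ω (s : Fin (t + 1)) => X s ω) MeasurableSpace.pi⟧
        =ᵐ[P] fun ω => (K (X t ω)).real A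

end Scaffold

open Scaffold

/-! Everything rests on a synchronous coupling: two copies of the chain are run from different
states with the same observations, and one round contracts their expected squared `Λ`-distance by
`(1 - γμ/4)^H`.

Within a round, client `c` has local iterates `x`, `y` and control variates `ξ`, `ξ'`. The corrected
difference `u = x - y + hγ(ξ - ξ')` after `h` steps undoes the drift caused by the control variates,
so it evolves only by `u ↦ u - γ(∇F(x) - ∇F(y))`. Cocoercivity of each stochastic gradient and
strong monotonicity of the expected one give a factor `1 - γμ/4` per step, up to an error
`γ(L+μ)h²‖γ(ξ-ξ')‖²` (`lintegral_ofReal_norm_sub_smul_sq_le`). Since `∑ h² ≤ H³/3` and `γH(L+μ) ≤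
1`, the errors of a round are absorbed by the control-variate part of the norm
(`lintegral_localIterate_sub_le_pow_mul`). Communication loses nothing: by the variance
decomposition, the squared `Λ`-norm of the new difference is exactly the client average of `‖u‖²` at
`h = H` (`lambdaNormSq_update_sub_update`).

The contraction makes the backward iterates of the random map converge almost surely to a limit
independent of the starting point. Its law is the unique stationary law, and a drift inequality with
Fatou's lemma bounds its second moment (`exists_invariant_of_contraction`). Applying the round to an
arbitrary coupling with common noise contracts the Wasserstein cost (`wassersteinSq_bind_le`), and
iteration against the stationary law gives the rate. The Markov property follows because the
observations of a round are independent of the past. -/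

namespace Scaffold

/-! ### Gradient inequalities for convex, smooth and strongly convex functions -/

section Convex

variable {E : Type*} [NormedAddCommGroup E] [InnerProductSpace ℝ E] [CompleteSpace E]
  {f : E → ℝ}

theorem hasDerivAt_comp_line {x g : E} (v : E) (t : ℝ) (h : HasGradientAt f g (x + t • v)) :
    HasDerivAt (fun s : ℝ => f (x + s • v)) (inner ℝ g v) t := by
  have h1 : HasDerivAt (fun s : ℝ => x + s • v) v t := by
    simpa using ((hasDerivAt_id t).smul_const v).const_add x
  have := h.hasFDerivAt.comp_hasDerivAt t h1
  simpa [Function.comp_def] using this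

/-- The first-order characterisation of convexity. -/
theorem ConvexOn.add_inner_gradient_le (hf : ConvexOn ℝ Set.univ f) {x g : E}
    (hg : HasGradientAt f g x) (y : E) : f x + inner ℝ g (y - x) ≤ f y := by
  have hc : ConvexOn ℝ Set.univ (fun s : ℝ => f (x + s • (y - x))) := by
    have := hf.comp_affineMap (AffineMap.lineMap x y : ℝ →ᵃ[ℝ] E)
    simp only [Set.preimage_univ] at this
    refine this.congr fun s _ => ?_
    simp [AffineMap.lineMap_apply, add_comm]
  have hd := hasDerivAt_comp_line (f := f) (x := x) (g := g) (y - x) 0 (by simpa using hg)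
  have := hc.le_slope_of_hasDerivAt (Set.mem_univ 0) (Set.mem_univ 1) one_pos hd
  simp [slope_def_field] at this
  linarith

/-- The descent lemma. -/
theorem le_add_inner_gradient_add_sq {L : ℝ} (hf : Differentiable ℝ f)
    (hL : ∀ x y, ‖gradient f x - gradient f y‖ ≤ L * ‖x - y‖) (x y : E) :
    f y ≤ f x + inner ℝ (gradient f x) (y - x) + L / 2 * ‖y - x‖ ^ 2 := by
  set v := y - x with hv
  -- The gap between `f` and its quadratic model along the segment; the Lipschitz bound makes its
  -- derivative nonpositive.
  let φ : ℝ → ℝ := fun t => f (x + t • v) - t * inner ℝ (gradient f x) v - L / 2 * t ^ 2 * ‖v‖ ^ 2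
  have hφ : ∀ t, HasDerivAt φ (inner ℝ (gradient f (x + t • v)) v - inner ℝ (gradient f x) v
      - L * t * ‖v‖ ^ 2) t := by
    intro t
    have h1 := hasDerivAt_comp_line (f := f) v t (hf (x + t • v)).hasGradientAt
    have h2 := (hasDerivAt_id t).mul_const (inner ℝ (gradient f x) v)
    have h3 := (((hasDerivAt_id t).pow 2).const_mul (L / 2)).mul_const (‖v‖ ^ 2)
    convert! (h1.sub h2).sub h3 using 1
    simp only [id_eq, Nat.cast_ofNat]
    ring
  have hanti : AntitoneOn φ (Set.Icc 0 1) := by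
    refine antitoneOn_of_deriv_nonpos (convex_Icc 0 1)
      (fun t _ => (hφ t).continuousAt.continuousWithinAt)
      (fun t _ => (hφ t).differentiableAt.differentiableWithinAt) fun t ht => ?_
    rw [interior_Icc] at ht
    rw [(hφ t).deriv, ← inner_sub_left]
    have h1 := real_inner_le_norm (gradient f (x + t • v) - gradient f x) v
    have h2 := hL (x + t • v) x
    rw [add_sub_cancel_left, norm_smul, Real.norm_of_nonneg ht.1.le] at h2
    nlinarith [norm_nonneg v, mul_le_mul_of_nonneg_right h2 (norm_nonneg v)]
  have := hanti (Set.left_mem_Icc.2 zero_le_one) (Set.right_mem_Icc.2 zero_le_one) zero_le_one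
  simp only [φ, zero_smul, one_smul, add_zero, zero_mul, one_mul, sub_zero] at this
  have hy : x + v = y := by rw [hv]; abel
  rw [hy] at this
  linarith

/-- The gradient of a convex `L`-smooth function is cocoercive. -/
theorem ConvexOn.norm_gradient_sub_sq_le {L : ℝ} (hL0 : 0 < L) (hc : ConvexOn ℝ Set.univ f)
    (hf : Differentiable ℝ f) (hL : ∀ x y, ‖gradient f x - gradient f y‖ ≤ L * ‖x - y‖) (x y : E) :
    ‖gradient f x - gradient f y‖ ^ 2 ≤ L * inner ℝ (gradient f x - gradient f y) (x - y) := by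
  -- Compare, at the gradient step `y - w/L`, the tangent at `x` from below with the descent lemma
  -- at `y` from above; this step length is the optimal one. Adding the inequality to its copy with
  -- `x` and `y` exchanged gives cocoercivity.
  have key : ∀ x y : E, f x + inner ℝ (gradient f x) (y - x)
      + 1 / (2 * L) * ‖gradient f y - gradient f x‖ ^ 2 ≤ f y := by
    intro x y
    set w := gradient f y - gradient f x with hw
    have h1 := hc.add_inner_gradient_le (hf x).hasGradientAt (y - (1 / L) • w)
    have h2 := le_add_inner_gradient_add_sq hf hL y (y - (1 / L) • w)
    have e1 : y - (1 / L) • w - x = (y - x) - (1 / L) • w := by abel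
    have e2 : y - (1 / L) • w - y = -((1 / L) • w) := by abel
    rw [e1, inner_sub_right, inner_smul_right] at h1
    rw [e2, inner_neg_right, inner_smul_right, norm_neg, norm_smul, mul_pow] at h2
    have h3 : ‖w‖ ^ 2 = inner ℝ (gradient f y) w - inner ℝ (gradient f x) w := by
      rw [← inner_sub_left, ← hw, real_inner_self_eq_norm_sq]
    have h4 : L / 2 * (‖(1 / L : ℝ)‖ ^ 2 * ‖w‖ ^ 2) = 1 / (2 * L) * ‖w‖ ^ 2 := by
      rw [Real.norm_eq_abs, sq_abs]; field_simp
    have h5 : 1 / L * ‖w‖ ^ 2 = 1 / (2 * L) * ‖w‖ ^ 2 + 1 / (2 * L) * ‖w‖ ^ 2 := by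
      field_simp; norm_num
    have h6 : 1 / L * ‖w‖ ^ 2
        = 1 / L * inner ℝ (gradient f y) w - 1 / L * inner ℝ (gradient f x) w := by
      rw [h3]; ring
    linarith
  have h1 := key x y
  have h2 := key y x
  rw [norm_sub_rev] at h1
  have h3 : inner ℝ (gradient f x) (y - x) = - inner ℝ (gradient f x) (x - y) := by
    rw [← inner_neg_right, neg_sub]
  have h4 : 1 / L * ‖gradient f x - gradient f y‖ ^ 2
      ≤ inner ℝ (gradient f x - gradient f y) (x - y) := by
    have h5 : 1 / L * ‖gradient f x - gradient f y‖ ^ 2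
      = 1 / (2 * L) * ‖gradient f x - gradient f y‖ ^ 2
        + 1 / (2 * L) * ‖gradient f x - gradient f y‖ ^ 2 := by
      field_simp; norm_num
    rw [inner_sub_left]
    linarith
  rw [one_div, inv_mul_le_iff₀ hL0] at h4
  exact h4

/-- The gradient of a strongly convex function is strongly monotone. -/
theorem StrongConvexOn.le_inner_gradient_sub {m : ℝ} (hc : StrongConvexOn Set.univ m f)
    (hf : Differentiable ℝ f) (x y : E) :
    m * ‖x - y‖ ^ 2 ≤ inner ℝ (gradient f x - gradient f y) (x - y) := by
  -- Subtracting `m/2 ‖·‖²` leaves a convex function, whose two tangent inequalities at `x` and `y`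
  -- are added.
  rw [strongConvexOn_iff_convex] at hc
  have hg : ∀ x, HasGradientAt (fun x => f x - m / 2 * ‖x‖ ^ 2) (gradient f x - m • x) x := by
    intro x
    rw [hasGradientAt_iff_hasFDerivAt]
    have h1 := (hf x).hasGradientAt.hasFDerivAt.sub
      (((hasFDerivAt_id x).norm_sq).const_mul (m / 2))
    convert! h1 using 1
    ext v
    simp
    ring
  have h1 := hc.add_inner_gradient_le (hg x) y
  have h2 := hc.add_inner_gradient_le (hg y) x
  have h3 : inner ℝ (gradient f x - m • x) (y - x)
      = - inner ℝ (gradient f x - m • x) (x - y) := by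
    rw [← inner_neg_right, neg_sub]
  have h4 : inner ℝ (gradient f y - m • y) (x - y) - inner ℝ (gradient f x - m • x) (x - y)
      = m * ‖x - y‖ ^ 2 - inner ℝ (gradient f x - gradient f y) (x - y) := by
    rw [← real_inner_self_eq_norm_sq, ← inner_sub_left,
      show gradient f y - m • y - (gradient f x - m • x)
        = m • (x - y) - (gradient f x - gradient f y) by rw [smul_sub]; abel,
      inner_sub_left, inner_smul_left]
    simp
  linarith

end Convex

/-! ### Stochastic gradients: measurability, integrability, expectation -/

section Gradient

variable {Z : Type*} [MeasurableSpace Z] {d : ℕ} {F : Z → Param d → ℝ}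

theorem continuous_gradient_of_lipschitz {f : Param d → ℝ} {L : ℝ}
    (hL : ∀ θ θ', ‖gradient f θ - gradient f θ'‖ ≤ L * ‖θ - θ'‖) : Continuous (gradient f) := by
  refine (LipschitzWith.of_dist_le_mul (K := L.toNNReal) fun x y => ?_).continuous
  rw [dist_eq_norm, dist_eq_norm]
  exact (hL x y).trans (mul_le_mul_of_nonneg_right (Real.le_coe_toNNReal L) (norm_nonneg _))

/-- Each directional derivative is a pointwise limit of difference quotients with increment
`1/(n+1)`, and finitely many directions determine the gradient. -/
theorem measurable_gradient (hm : ∀ θ, Measurable fun z => F z θ)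
    (hd : ∀ z, Differentiable ℝ (F z)) (θ : Param d) :
    Measurable fun z => gradient (F z) θ := by
  have h1 : ∀ v : Param d, Measurable fun z => inner ℝ v (gradient (F z) θ) := by
    intro v
    have hlim : ∀ z, Tendsto (fun n : ℕ => (1 / ((n : ℝ) + 1))⁻¹ •
        (F z (θ + (1 / ((n : ℝ) + 1)) • v) - F z θ)) atTop (𝓝 (inner ℝ v (gradient (F z) θ))) := by
      intro z
      have h2 := hasDerivAt_comp_line (f := F z) (x := θ) (g := gradient (F z) θ) v 0
        (by simpa using (hd z θ).hasGradientAt)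
      have h3 := hasDerivAt_iff_tendsto_slope_zero.1 h2
      have h4 : Tendsto (fun n : ℕ => 1 / ((n : ℝ) + 1)) atTop (𝓝[≠] 0) :=
        tendsto_nhdsWithin_iff.2 ⟨tendsto_one_div_add_atTop_nhds_zero_nat,
          Eventually.of_forall fun n => (Nat.one_div_pos_of_nat).ne'⟩
      have h5 := h3.comp h4
      rw [real_inner_comm]
      simpa [Function.comp_def] using h5
    refine measurable_of_tendsto_metrizable (fun n => ?_) (tendsto_pi_nhds.2 hlim)
    exact ((hm _).sub (hm _)).const_smul (1 / ((n : ℝ) + 1))⁻¹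
  have h2 : (fun z => gradient (F z) θ) = fun z => ∑ i, inner ℝ (EuclideanSpace.basisFun (Fin d) ℝ i)
      (gradient (F z) θ) • EuclideanSpace.basisFun (Fin d) ℝ i := by
    funext z
    exact ((EuclideanSpace.basisFun (Fin d) ℝ).sum_repr' _).symm
  rw [h2]
  exact Finset.measurable_sum _ fun i _ => (h1 _).smul_const _

theorem measurable_gradient_uncurry {L : ℝ} (hm : ∀ θ, Measurable fun z => F z θ)
    (hd : ∀ z, Differentiable ℝ (F z))
    (hL : ∀ z θ θ', ‖gradient (F z) θ - gradient (F z) θ'‖ ≤ L * ‖θ - θ'‖) :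
    Measurable fun p : Param d × Z => gradient (F p.2) p.1 :=
  measurable_uncurry_of_continuous_of_measurable
    (u := fun (θ : Param d) z => gradient (F z) θ)
    (fun z => continuous_gradient_of_lipschitz (hL z)) (fun θ => measurable_gradient hm hd θ)

theorem memLp_gradient {ν : Measure Z} [IsProbabilityMeasure ν] (hm : ∀ θ, Measurable fun z => F z θ)
    (hd : ∀ z, Differentiable ℝ (F z)) {θ g : Param d}
    (hfin : ∫⁻ z, ‖gradient (F z) θ - g‖ₑ ^ 2 ∂ν ≠ ∞) :
    MemLp (fun z => gradient (F z) θ) 2 ν := by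
  have h1 : MemLp (fun z => gradient (F z) θ - g) 2 ν := by
    refine ⟨((measurable_gradient hm hd θ).sub_const g).aestronglyMeasurable, ?_⟩
    rw [eLpNorm_lt_top_iff_lintegral_rpow_enorm_lt_top two_ne_zero ENNReal.ofNat_ne_top]
    simpa [lt_top_iff_ne_top] using hfin
  simpa [Pi.add_def] using h1.add (memLp_const g)

/-- Differentiation under the integral: on the unit ball around `θ` the Lipschitz bound dominates
the gradient by `‖∇F^z(θ)‖ + L`, which is integrable. -/
theorem hasGradientAt_localRisk {ν : Measure Z} [IsProbabilityMeasure ν] {L : ℝ} (hL0 : 0 < L)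
    (hm : ∀ θ, Measurable fun z => F z θ) (hi : ∀ θ, Integrable (fun z => F z θ) ν)
    (hd : ∀ z, Differentiable ℝ (F z))
    (hL : ∀ z θ θ', ‖gradient (F z) θ - gradient (F z) θ'‖ ≤ L * ‖θ - θ'‖)
    (hg : ∀ θ, Integrable (fun z => gradient (F z) θ) ν) (θ : Param d) :
    HasGradientAt (localRisk F ν) (∫ z, gradient (F z) θ ∂ν) θ := by
  rw [hasGradientAt_iff_hasFDerivAt]
  have hcomm : InnerProductSpace.toDual ℝ (Param d) (∫ z, gradient (F z) θ ∂ν)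
      = ∫ z, InnerProductSpace.toDual ℝ (Param d) (gradient (F z) θ) ∂ν :=
    (ContinuousLinearMap.integral_comp_comm
      ((InnerProductSpace.toDual ℝ (Param d)).toContinuousLinearEquiv.toContinuousLinearMap)
      (hg θ)).symm
  rw [hcomm]
  refine hasFDerivAt_integral_of_dominated_of_fderiv_le (F := fun θ z => F z θ)
    (F' := fun θ z => InnerProductSpace.toDual ℝ (Param d) (gradient (F z) θ))
    (bound := fun z => ‖gradient (F z) θ‖ + L * 1) (Metric.ball_mem_nhds θ one_pos)
    (Eventually.of_forall fun θ => (hm θ).aestronglyMeasurable) (hi θ) ?_ ?_ ?_ ?_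
  · exact (InnerProductSpace.toDual ℝ (Param d)).continuous.comp_aestronglyMeasurable
      (hg θ).aestronglyMeasurable
  · refine Eventually.of_forall fun z x hx => ?_
    rw [LinearIsometryEquiv.norm_map]
    have h1 := norm_le_norm_add_norm_sub' (gradient (F z) x) (gradient (F z) θ)
    have h2 := hL z x θ
    rw [Metric.mem_ball, dist_eq_norm] at hx
    have h3 := mul_le_mul_of_nonneg_left hx.le hL0.le
    linarith
  · exact (hg θ).norm.add (integrable_const _)
  · exact Eventually.of_forall fun z x _ => (hd z x).hasGradientAt.hasFDerivAt

/-- Stochastic gradients are strongly monotone in expectation. -/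
theorem le_integral_inner_gradient_sub {ν : Measure Z} [IsProbabilityMeasure ν] {L μ : ℝ}
    (hL0 : 0 < L)
    (hm : ∀ θ, Measurable fun z => F z θ) (hi : ∀ θ, Integrable (fun z => F z θ) ν)
    (hd : ∀ z, Differentiable ℝ (F z))
    (hL : ∀ z θ θ', ‖gradient (F z) θ - gradient (F z) θ'‖ ≤ L * ‖θ - θ'‖)
    (hg : ∀ θ, Integrable (fun z => gradient (F z) θ) ν)
    (hs : StrongConvexOn Set.univ μ (localRisk F ν)) (x y : Param d) :
    μ * ‖x - y‖ ^ 2 ≤ ∫ z, inner ℝ (gradient (F z) x - gradient (F z) y) (x - y) ∂ν := by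
  have hgr := hasGradientAt_localRisk hL0 hm hi hd hL hg
  have h1 := hs.le_inner_gradient_sub (fun θ => (hgr θ).differentiableAt) x y
  rw [(hgr x).gradient, (hgr y).gradient, ← integral_sub (hg x) (hg y), real_inner_comm] at h1
  have h2 := integral_inner (𝕜 := ℝ) ((hg x).sub (hg y)) (x - y)
  simp only [Pi.sub_apply] at h2
  rw [← h2] at h1
  simpa only [real_inner_comm] using h1

end Gradient

/-! ### Local steps: contraction of the drift-corrected difference -/

section Local

variable {Z : Type*} {d : ℕ} {F : Z → Param d → ℝ}

/-- Expanding the square leaves `-2γ⟨g,δ⟩`, a cross term and `γ²‖g‖²`. Cocoercivity with `γL ≤ 1/2`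
bounds the last by `γ/2 ⟨g,δ⟩`; Young's inequality weighted by `L`, then cocoercivity, bounds the
cross term by `γ⟨g,δ⟩ + γLh²‖η‖²`. A share `-γ/2 ⟨g,δ⟩` survives. -/
theorem norm_sub_smul_sq_le {E : Type*} [NormedAddCommGroup E] [InnerProductSpace ℝ E]
    {L γ h : ℝ} (hL0 : 0 < L) (hγ : 0 < γ) (hγL : γ * L ≤ 1 / 2)
    {u g δ η : E} (hu : u = δ + h • η) (hg : ‖g‖ ^ 2 ≤ L * inner ℝ g δ) :
    ‖u - γ • g‖ ^ 2 ≤ ‖u‖ ^ 2 - γ / 2 * inner ℝ g δ + γ * L * h ^ 2 * ‖η‖ ^ 2 := by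
  have h1 : ‖u - γ • g‖ ^ 2
      = ‖u‖ ^ 2 - 2 * γ * (inner ℝ g δ + h * inner ℝ g η) + γ ^ 2 * ‖g‖ ^ 2 := by
    have e1 : inner ℝ u g = inner ℝ g δ + h * inner ℝ g η := by
      rw [real_inner_comm, hu, inner_add_right, inner_smul_right]
    rw [norm_sub_sq_real, inner_smul_right, norm_smul, mul_pow, Real.norm_eq_abs, sq_abs, e1]
    ring
  have h2 : 0 ≤ ‖g‖ ^ 2 + 2 * (L * h) * inner ℝ g η + L ^ 2 * h ^ 2 * ‖η‖ ^ 2 := by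
    have h3 := sq_nonneg ‖g + (L * h) • η‖
    rw [norm_add_sq_real, inner_smul_right, norm_smul, mul_pow, Real.norm_eq_abs, sq_abs] at h3
    linarith
  have h4 : 0 ≤ inner ℝ g δ := by
    by_contra hneg
    have := mul_neg_of_pos_of_neg hL0 (not_le.1 hneg)
    linarith [sq_nonneg ‖g‖]
  have h5 : - (2 * h * inner ℝ g η) ≤ inner ℝ g δ + L * h ^ 2 * ‖η‖ ^ 2 := by
    have : L * (- (2 * h * inner ℝ g η)) ≤ L * (inner ℝ g δ + L * h ^ 2 * ‖η‖ ^ 2) := by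
      linarith
    exact le_of_mul_le_mul_left this hL0
  have h6 : γ ^ 2 * ‖g‖ ^ 2 ≤ γ / 2 * inner ℝ g δ := by
    have e1 := mul_le_mul_of_nonneg_left hg (sq_nonneg γ)
    have e2 := mul_le_mul_of_nonneg_right hγL (mul_nonneg hγ.le h4)
    linarith
  have h7 := mul_le_mul_of_nonneg_left h5 hγ.le
  rw [h1]
  linarith

theorem norm_sq_le_two_mul {E : Type*} [NormedAddCommGroup E] [InnerProductSpace ℝ E] (a b : E) :
    ‖a + b‖ ^ 2 ≤ 2 * ‖a‖ ^ 2 + 2 * ‖b‖ ^ 2 := by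
  have := parallelogram_law_with_norm ℝ a b
  nlinarith [sq_nonneg ‖a - b‖]

theorem continuous_localIterate {γ : ℝ} (hG : ∀ z, Continuous (gradient (F z))) (h : ℕ)
    (z : Fin h → Z) :
    Continuous fun p : Param d × Param d => localIterate F γ p.1 p.2 h z := by
  induction h with
  | zero => exact continuous_fst
  | succ h ih =>
    have h1 := ih (fun i => z i.castSucc)
    exact h1.sub ((((hG (z (Fin.last h))).comp h1).add continuous_snd).const_smul γ)

variable [MeasurableSpace Z]

/-- In expectation the surviving term is at most `-γμ/2 ‖x - y‖²`. As monotonicity sees `x - y` and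
not `u`, the bound `‖u‖² ≤ 2‖x-y‖² + 2h²‖η‖²` converts it, halving the rate to `γμ/4` and adding `μ`
to the error constant. -/
theorem lintegral_ofReal_norm_sub_smul_sq_le {ν : Measure Z} [IsProbabilityMeasure ν] {L μ γ : ℝ}
    (hL0 : 0 < L) (hμ : 0 < μ) (hγ : 0 < γ) (hγL : γ * L ≤ 1 / 2)
    (hm : ∀ θ, Measurable fun z => F z θ) (hi : ∀ θ, Integrable (fun z => F z θ) ν)
    (hd : ∀ z, Differentiable ℝ (F z))
    (hc : ∀ z, ConvexOn ℝ Set.univ (F z))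
    (hL : ∀ z θ θ', ‖gradient (F z) θ - gradient (F z) θ'‖ ≤ L * ‖θ - θ'‖)
    (hg : ∀ θ, Integrable (fun z => gradient (F z) θ) ν)
    (hs : StrongConvexOn Set.univ μ (localRisk F ν)) {x y u η : Param d} {h : ℝ}
    (hu : u = (x - y) + h • η) :
    ∫⁻ z, ENNReal.ofReal (‖u - γ • (gradient (F z) x - gradient (F z) y)‖ ^ 2) ∂ν
      ≤ ENNReal.ofReal ((1 - γ * μ / 4) * ‖u‖ ^ 2 + γ * (L + μ) * h ^ 2 * ‖η‖ ^ 2) := by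
  have hint : Integrable (fun z => inner ℝ (gradient (F z) x - gradient (F z) y) (x - y)) ν :=
    ((hg x).sub (hg y)).inner_const _
  calc _ ≤ ∫⁻ z, ENNReal.ofReal (‖u‖ ^ 2
        - γ / 2 * inner ℝ (gradient (F z) x - gradient (F z) y) (x - y)
        + γ * L * h ^ 2 * ‖η‖ ^ 2) ∂ν :=
      lintegral_mono fun z => ENNReal.ofReal_le_ofReal (norm_sub_smul_sq_le hL0 hγ hγL hu
        (ConvexOn.norm_gradient_sub_sq_le hL0 (hc z) (hd z) (hL z) x y))
    _ = ENNReal.ofReal (∫ z, (‖u‖ ^ 2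
        - γ / 2 * inner ℝ (gradient (F z) x - gradient (F z) y) (x - y)
        + γ * L * h ^ 2 * ‖η‖ ^ 2) ∂ν) := by
      refine (ofReal_integral_eq_lintegral_ofReal
        (((integrable_const _).sub (hint.const_mul _)).add (integrable_const _))
        (Eventually.of_forall fun z => ?_)).symm
      exact (sq_nonneg _).trans (norm_sub_smul_sq_le hL0 hγ hγL hu
        (ConvexOn.norm_gradient_sub_sq_le hL0 (hc z) (hd z) (hL z) x y))
    _ ≤ _ := by
      refine ENNReal.ofReal_le_ofReal ?_
      have h0 : ∫ z, (‖u‖ ^ 2 - γ / 2 * inner ℝ (gradient (F z) x - gradient (F z) y) (x - y)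
          + γ * L * h ^ 2 * ‖η‖ ^ 2) ∂ν = ‖u‖ ^ 2
          - γ / 2 * ∫ z, inner ℝ (gradient (F z) x - gradient (F z) y) (x - y) ∂ν
          + γ * L * h ^ 2 * ‖η‖ ^ 2 := by
        have e1 := integral_add ((integrable_const (‖u‖ ^ 2)).sub (hint.const_mul (γ / 2)))
          (integrable_const (μ := ν) (γ * L * h ^ 2 * ‖η‖ ^ 2))
        have e2 := integral_sub (integrable_const (‖u‖ ^ 2)) (hint.const_mul (γ / 2))
        simp only [Pi.sub_apply, integral_const, probReal_univ, smul_eq_mul, one_mul,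
          integral_const_mul] at e1 e2
        rw [e1, e2]
      rw [h0]
      have h1 := le_integral_inner_gradient_sub hL0 hm hi hd hL hg hs x y
      have h2 : ‖u‖ ^ 2 ≤ 2 * ‖x - y‖ ^ 2 + 2 * (h ^ 2 * ‖η‖ ^ 2) := by
        have := norm_sq_le_two_mul (x - y) (h • η)
        rwa [← hu, norm_smul, mul_pow, Real.norm_eq_abs, sq_abs] at this
      have h3 := mul_le_mul_of_nonneg_left h1 hγ.le
      have h4 := mul_le_mul_of_nonneg_left h2 (mul_pos hγ hμ).le
      have h5 : 0 ≤ γ * μ * (h ^ 2 * ‖η‖ ^ 2) := by positivity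
      nlinarith

theorem measurable_localIterate {γ : ℝ}
    (hG : Measurable fun p : Param d × Z => gradient (F p.2) p.1) (h : ℕ) :
    Measurable fun p : (Param d × Param d) × (Fin h → Z) => localIterate F γ p.1.1 p.1.2 h p.2 := by
  induction h with
  | zero => exact measurable_fst.fst
  | succ h ih =>
    have h1 : Measurable fun p : (Param d × Param d) × (Fin (h + 1) → Z) =>
        localIterate F γ p.1.1 p.1.2 h (fun i => p.2 i.castSucc) :=
      ih.comp (f := fun p : (Param d × Param d) × (Fin (h + 1) → Z) =>
        (p.1, fun i : Fin h => p.2 i.castSucc)) (by fun_prop)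
    have h2 := hG.comp (h1.prodMk ((measurable_pi_apply (Fin.last h)).comp measurable_snd))
    exact h1.sub ((h2.add measurable_fst.snd).const_smul γ)

theorem measurable_localIterate_comp {γ : ℝ} {α : Type*} [MeasurableSpace α]
    (hG : Measurable fun p : Param d × Z => gradient (F p.2) p.1) (θ ξ : Param d) {h : ℕ}
    {w : α → Fin h → Z} (hw : Measurable w) :
    Measurable fun a => localIterate F γ θ ξ h (w a) := by
  have := (measurable_localIterate (γ := γ) hG h).comp ((measurable_const (a := (θ, ξ))).prodMk hw)
  exact this

theorem three_mul_sum_range_sq_le (n : ℕ) :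
    3 * ∑ k ∈ Finset.range n, (k : ℝ) ^ 2 ≤ (n : ℝ) ^ 3 := by
  induction n with
  | zero => simp
  | succ n ih =>
    rw [Finset.sum_range_succ]
    push_cast
    have : (0 : ℝ) ≤ n := n.cast_nonneg
    linarith [show ((n : ℝ) + 1) ^ 3 = n ^ 3 + 3 * n ^ 2 + 3 * n + 1 by ring]

/-- The step subtracts `γ(ξ - ξ')` from the difference of the iterates while the correction gains
one more copy, so only gradients remain. The last observation is independent of the earlier ones and
is integrated first, with the current iterates frozen. -/
theorem lintegral_localIterate_succ_sub_le {ν : Measure Z} [IsProbabilityMeasure ν] {L μ γ : ℝ}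
    (hL0 : 0 < L) (hμ : 0 < μ) (hγ : 0 < γ) (hγL : γ * L ≤ 1 / 2) (hγμ : γ * μ ≤ 1)
    (hm : ∀ θ, Measurable fun z => F z θ) (hi : ∀ θ, Integrable (fun z => F z θ) ν)
    (hd : ∀ z, Differentiable ℝ (F z))
    (hc : ∀ z, ConvexOn ℝ Set.univ (F z))
    (hL : ∀ z θ θ', ‖gradient (F z) θ - gradient (F z) θ'‖ ≤ L * ‖θ - θ'‖)
    (hg : ∀ θ, Integrable (fun z => gradient (F z) θ) ν)
    (hs : StrongConvexOn Set.univ μ (localRisk F ν)) (θ θ' ξ ξ' : Param d) (h : ℕ) :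
    ∫⁻ z, ENNReal.ofReal (‖localIterate F γ θ ξ (h + 1) z - localIterate F γ θ' ξ' (h + 1) z
        + ((h + 1 : ℕ) : ℝ) • γ • (ξ - ξ')‖ ^ 2) ∂(Measure.pi fun _ : Fin (h + 1) => ν)
      ≤ ENNReal.ofReal (1 - γ * μ / 4) * (∫⁻ z, ENNReal.ofReal (‖localIterate F γ θ ξ h z
            - localIterate F γ θ' ξ' h z + (h : ℝ) • γ • (ξ - ξ')‖ ^ 2)
            ∂(Measure.pi fun _ : Fin h => ν))
        + ENNReal.ofReal (γ * (L + μ) * (h : ℝ) ^ 2 * ‖γ • (ξ - ξ')‖ ^ 2) := by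
  have hρ0 : 0 ≤ 1 - γ * μ / 4 := by linarith
  have hG := measurable_gradient_uncurry hm hd hL
  have hmeas : ∀ (h : ℕ) (θ ξ : Param d), Measurable fun z => localIterate F γ θ ξ h z :=
    fun h θ ξ => measurable_localIterate_comp hG θ ξ measurable_id
  set η := γ • (ξ - ξ') with hη
  set u : (Fin h → Z) → Param d := fun w =>
    localIterate F γ θ ξ h w - localIterate F γ θ' ξ' h w + (h : ℝ) • η with hu
  have humeas : Measurable u := ((hmeas h θ ξ).sub (hmeas h θ' ξ')).add_const _
  set G : Z × (Fin h → Z) → ℝ≥0∞ := fun p => ENNReal.ofReal (‖u p.2 - γ •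
    (gradient (F p.1) (localIterate F γ θ ξ h p.2)
      - gradient (F p.1) (localIterate F γ θ' ξ' h p.2))‖ ^ 2) with hGdef
  have hGm : Measurable G := by
    have h1 := hG.comp (((hmeas h θ ξ).comp measurable_snd).prodMk
      (measurable_fst (α := Z) (β := Fin h → Z)))
    have h2 := hG.comp (((hmeas h θ' ξ').comp measurable_snd).prodMk
      (measurable_fst (α := Z) (β := Fin h → Z)))
    exact (((humeas.comp measurable_snd).sub ((h1.sub h2).const_smul γ)).norm.pow_const
      2).ennreal_ofReal
  have hmp := measurePreserving_piFinSuccAbove (fun _ : Fin (h + 1) => ν) (Fin.last h)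
  calc _ = ∫⁻ z, G (MeasurableEquiv.piFinSuccAbove (fun _ => Z) (Fin.last h) z)
        ∂(Measure.pi fun _ : Fin (h + 1) => ν) := by
        refine lintegral_congr fun z => ?_
        have e : MeasurableEquiv.piFinSuccAbove (fun _ => Z) (Fin.last h) z
            = (z (Fin.last h), fun i => z i.castSucc) := by
          refine Prod.ext rfl (funext fun j => ?_)
          simp [MeasurableEquiv.piFinSuccAbove, Fin.insertNthEquiv, Fin.init]
        rw [e]
        simp only [hGdef, hu, localIterate]
        congr 3
        rw [hη]
        push_cast
        module
    _ = ∫⁻ p, G p ∂(ν.prod (Measure.pi fun _ : Fin h => ν)) := hmp.lintegral_comp hGm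
    _ = ∫⁻ w, ∫⁻ z, G (z, w) ∂ν ∂(Measure.pi fun _ : Fin h => ν) :=
        lintegral_prod_symm _ hGm.aemeasurable
    _ ≤ ∫⁻ w, (ENNReal.ofReal (1 - γ * μ / 4) * ENNReal.ofReal (‖u w‖ ^ 2)
          + ENNReal.ofReal (γ * (L + μ) * (h : ℝ) ^ 2 * ‖η‖ ^ 2))
          ∂(Measure.pi fun _ : Fin h => ν) := by
        refine lintegral_mono fun w => ?_
        rw [← ENNReal.ofReal_mul hρ0, ← ENNReal.ofReal_add
          (mul_nonneg hρ0 (sq_nonneg _)) (by positivity)]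
        exact lintegral_ofReal_norm_sub_smul_sq_le (u := u w) (η := η) (h := h)
          (x := localIterate F γ θ ξ h w) (y := localIterate F γ θ' ξ' h w)
          hL0 hμ hγ hγL hm hi hd hc hL hg hs (congrFun hu w)
    _ = _ := by
        rw [lintegral_add_right _ measurable_const, lintegral_const_mul _
          (humeas.norm.pow_const 2).ennreal_ofReal, lintegral_const, measure_univ, mul_one]

/-- Unrolling the one-step bound; the discount on errors already accumulated is dropped, being at
most one. -/
theorem lintegral_localIterate_sub_le {ν : Measure Z} [IsProbabilityMeasure ν] {L μ γ : ℝ}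
    (hL0 : 0 < L) (hμ : 0 < μ) (hγ : 0 < γ) (hγL : γ * L ≤ 1 / 2) (hγμ : γ * μ ≤ 1)
    (hm : ∀ θ, Measurable fun z => F z θ) (hi : ∀ θ, Integrable (fun z => F z θ) ν)
    (hd : ∀ z, Differentiable ℝ (F z))
    (hc : ∀ z, ConvexOn ℝ Set.univ (F z))
    (hL : ∀ z θ θ', ‖gradient (F z) θ - gradient (F z) θ'‖ ≤ L * ‖θ - θ'‖)
    (hg : ∀ θ, Integrable (fun z => gradient (F z) θ) ν)
    (hs : StrongConvexOn Set.univ μ (localRisk F ν)) (θ θ' ξ ξ' : Param d) (h : ℕ) :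
    ∫⁻ z, ENNReal.ofReal (‖localIterate F γ θ ξ h z - localIterate F γ θ' ξ' h z
        + (h : ℝ) • γ • (ξ - ξ')‖ ^ 2) ∂(Measure.pi fun _ : Fin h => ν)
      ≤ ENNReal.ofReal ((1 - γ * μ / 4) ^ h * ‖θ - θ'‖ ^ 2
        + γ * (L + μ) * (∑ k ∈ Finset.range h, (k : ℝ) ^ 2) * ‖γ • (ξ - ξ')‖ ^ 2) := by
  have hρ0 : 0 ≤ 1 - γ * μ / 4 := by linarith
  have hρ1 : 1 - γ * μ / 4 ≤ 1 := by linarith [mul_pos hγ hμ]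
  induction h with
  | zero => simp [localIterate]
  | succ h ih =>
    refine (lintegral_localIterate_succ_sub_le hL0 hμ hγ hγL hγμ hm hi hd hc hL hg hs
      θ θ' ξ ξ' h).trans ((add_le_add_left (mul_le_mul_right ih _) _).trans ?_)
    generalize ‖γ • (ξ - ξ')‖ = η
    have hS : 0 ≤ γ * (L + μ) * (∑ k ∈ Finset.range h, (k : ℝ) ^ 2) * η ^ 2 := by positivity
    have hS' : 0 ≤ (1 - γ * μ / 4) ^ h * ‖θ - θ'‖ ^ 2 :=
      mul_nonneg (pow_nonneg hρ0 _) (sq_nonneg _)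
    rw [← ENNReal.ofReal_mul hρ0, ← ENNReal.ofReal_add (mul_nonneg hρ0 (add_nonneg hS' hS))
      (by positivity)]
    refine ENNReal.ofReal_le_ofReal ?_
    rw [Finset.sum_range_succ, pow_succ' (1 - γ * μ / 4)]
    have h1 := mul_le_of_le_one_left hS hρ1
    linarith

/-- One round of local steps contracts the drift-corrected difference of two local iterates. -/
theorem lintegral_localIterate_sub_le_pow_mul {ν : Measure Z} [IsProbabilityMeasure ν] {L μ γ : ℝ}
    (hL0 : 0 < L) (hμ : 0 < μ) (hγ : 0 < γ) (hγL : γ * L ≤ 1 / 2)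
    (hm : ∀ θ, Measurable fun z => F z θ) (hi : ∀ θ, Integrable (fun z => F z θ) ν)
    (hd : ∀ z, Differentiable ℝ (F z))
    (hc : ∀ z, ConvexOn ℝ Set.univ (F z))
    (hL : ∀ z θ θ', ‖gradient (F z) θ - gradient (F z) θ'‖ ≤ L * ‖θ - θ'‖)
    (hg : ∀ θ, Integrable (fun z => gradient (F z) θ) ν)
    (hs : StrongConvexOn Set.univ μ (localRisk F ν)) (θ θ' ξ ξ' : Param d) {H : ℕ} (hH : 0 < H)
    (hγH : γ * H * (L + μ) ≤ 1) :
    ∫⁻ z, ENNReal.ofReal (‖localIterate F γ θ ξ H z - localIterate F γ θ' ξ' H z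
        + (γ * H) • (ξ - ξ')‖ ^ 2) ∂(Measure.pi fun _ : Fin H => ν)
      ≤ ENNReal.ofReal ((1 - γ * μ / 4) ^ H
        * (‖θ - θ'‖ ^ 2 + γ ^ 2 * (H : ℝ) ^ 2 * ‖ξ - ξ'‖ ^ 2)) := by
  have hH1 : (1 : ℝ) ≤ H := by exact_mod_cast hH
  have hγμH : γ * μ * H ≤ 1 := by
    have : 0 < γ * H * L := by positivity
    linarith [show γ * H * (L + μ) = γ * H * L + γ * μ * H by ring]
  have hγμ : γ * μ ≤ 1 := (le_mul_of_one_le_right (mul_pos hγ hμ).le hH1).trans hγμH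
  have h1 := lintegral_localIterate_sub_le hL0 hμ hγ hγL hγμ hm hi hd hc hL hg hs θ θ' ξ ξ' H
  rw [smul_smul, mul_comm (H : ℝ) γ] at h1
  refine h1.trans (ENNReal.ofReal_le_ofReal ?_)
  -- Bernoulli's inequality with `γμH ≤ 1`. The accumulated error constant `1/3` below then fits
  -- under the contraction factor.
  have h2 : (3 / 4 : ℝ) ≤ (1 - γ * μ / 4) ^ H := by
    have := one_add_mul_le_pow (a := -(γ * μ / 4)) (by linarith) H
    rw [← sub_eq_add_neg] at this
    linarith
  have h3 : γ * (L + μ) * ∑ k ∈ Finset.range H, (k : ℝ) ^ 2 ≤ 1 / 3 * (H : ℝ) ^ 2 := by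
    have e1 := mul_le_mul_of_nonneg_left (three_mul_sum_range_sq_le H)
      (show 0 ≤ γ * (L + μ) by positivity)
    have e2 := mul_le_mul_of_nonneg_right hγH (sq_nonneg (H : ℝ))
    linarith
  rw [norm_smul, mul_pow, Real.norm_eq_abs, sq_abs, mul_add]
  have h4 : γ * (L + μ) * (∑ k ∈ Finset.range H, (k : ℝ) ^ 2) ≤ (1 - γ * μ / 4) ^ H * (H : ℝ) ^ 2 :=
    h3.trans (mul_le_mul_of_nonneg_right (by linarith) (sq_nonneg _))
  have h5 := mul_le_mul_of_nonneg_right h4 (show 0 ≤ γ ^ 2 * ‖ξ - ξ'‖ ^ 2 by positivity)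
  linarith

/-- A Lipschitz gradient grows at most linearly, so square integrability at the origin propagates
through the recursion. -/
theorem memLp_localIterate {Ω : Type*} [MeasurableSpace Ω] {P : Measure Ω} [IsProbabilityMeasure P]
    {L γ : ℝ} (hG : Measurable fun p : Param d × Z => gradient (F p.2) p.1)
    (hL : ∀ z θ θ', ‖gradient (F z) θ - gradient (F z) θ'‖ ≤ L * ‖θ - θ'‖) (θ ξ : Param d) (h : ℕ)
    {ζ : Fin h → Ω → Z} (hζ : ∀ i, Measurable (ζ i))
    (hζ2 : ∀ i, MemLp (fun ω => gradient (F (ζ i ω)) 0) 2 P) :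
    MemLp (fun ω => localIterate F γ θ ξ h (fun i => ζ i ω)) 2 P := by
  induction h with
  | zero => exact memLp_const θ
  | succ h ih =>
    have h1 := ih (ζ := fun i => ζ i.castSucc) (fun i => hζ _) (fun i => hζ2 _)
    have h2 : Measurable fun ω => localIterate F γ θ ξ h (fun i => ζ i.castSucc ω) :=
      measurable_localIterate_comp hG θ ξ (measurable_pi_lambda _ fun i => hζ _)
    have h3 : MemLp (fun ω => gradient (F (ζ (Fin.last h) ω))
        (localIterate F γ θ ξ h (fun i => ζ i.castSucc ω))) 2 P := by
      refine ((hζ2 (Fin.last h)).norm.add (h1.norm.const_mul L)).mono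
        (hG.comp (h2.prodMk (hζ _))).aestronglyMeasurable (Eventually.of_forall fun ω => ?_)
      refine le_trans ?_ (le_abs_self _)
      have e1 := norm_le_norm_add_norm_sub' (gradient (F (ζ (Fin.last h) ω))
        (localIterate F γ θ ξ h (fun i => ζ i.castSucc ω))) (gradient (F (ζ (Fin.last h) ω)) 0)
      have e2 := hL (ζ (Fin.last h) ω) (localIterate F γ θ ξ h (fun i => ζ i.castSucc ω)) 0
      rw [sub_zero] at e2
      simp only [Pi.add_apply]
      linarith
    exact h1.sub ((h3.add (memLp_const ξ)).const_smul γ)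

end Local

/-! ### The weighted norm and the variance decomposition -/

section LambdaNorm

variable {d N : ℕ}

theorem lambdaNormSq_nonneg (γ : ℝ) (H : ℕ) (X : Param d × (Fin N → Param d)) :
    0 ≤ lambdaNormSq γ H X := by
  unfold lambdaNormSq; positivity

@[fun_prop]
theorem continuous_lambdaNormSq (γ : ℝ) (H : ℕ) :
    Continuous (lambdaNormSq γ H : Param d × (Fin N → Param d) → ℝ) := by
  unfold lambdaNormSq; fun_prop

theorem lambdaNormSq_neg (γ : ℝ) (H : ℕ) (X : Param d × (Fin N → Param d)) :
    lambdaNormSq γ H (-X) = lambdaNormSq γ H X := by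
  simp [lambdaNormSq]

/-- Young's inequality in each component. A small `ε` keeps the first coefficient near one, as a
drift inequality with coefficient below one requires. -/
theorem lambdaNormSq_add_le {γ : ℝ} {H : ℕ} {ε : ℝ} (hε : 0 < ε)
    (X Y : Param d × (Fin N → Param d)) :
    lambdaNormSq γ H (X + Y) ≤ (1 + ε) * lambdaNormSq γ H X + (1 + 1 / ε) * lambdaNormSq γ H Y := by
  have key : ∀ a b : Param d, ‖a + b‖ ^ 2 ≤ (1 + ε) * ‖a‖ ^ 2 + (1 + 1 / ε) * ‖b‖ ^ 2 := by
    intro a b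
    have h1 : ‖a + b‖ ^ 2 ≤ (‖a‖ + ‖b‖) ^ 2 := by gcongr; exact norm_add_le a b
    have h2 : (‖a‖ + ‖b‖) ^ 2
        = (1 + ε) * ‖a‖ ^ 2 + (1 + 1 / ε) * ‖b‖ ^ 2 - ε⁻¹ * (ε * ‖a‖ - ‖b‖) ^ 2 := by
      field_simp; ring
    have h3 : 0 ≤ ε⁻¹ * (ε * ‖a‖ - ‖b‖) ^ 2 := by positivity
    linarith
  have h1 : ∑ c, ‖(X + Y).2 c‖ ^ 2
      ≤ (1 + ε) * ∑ c, ‖X.2 c‖ ^ 2 + (1 + 1 / ε) * ∑ c, ‖Y.2 c‖ ^ 2 := by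
    rw [Finset.mul_sum, Finset.mul_sum, ← Finset.sum_add_distrib]
    exact Finset.sum_le_sum fun c _ => key _ _
  have h2 := mul_le_mul_of_nonneg_left h1
    (show 0 ≤ γ ^ 2 * (H : ℝ) ^ 2 / (N : ℝ) by positivity)
  have h3 := key X.1 Y.1
  unfold lambdaNormSq
  simp only [Prod.fst_add] at h3 ⊢
  linarith

theorem lambdaNormSq_sub_le (γ : ℝ) (H : ℕ) (X Y : Param d × (Fin N → Param d)) :
    lambdaNormSq γ H (X - Y) ≤ 2 * lambdaNormSq γ H X + 2 * lambdaNormSq γ H Y := by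
  have := lambdaNormSq_add_le (γ := γ) (H := H) one_pos X (-Y)
  rw [lambdaNormSq_neg, ← sub_eq_add_neg] at this
  norm_num at this
  exact this

/-- The Euclidean topology of the state space is controlled by the weighted norm. -/
theorem norm_sq_le_mul_lambdaNormSq {γ : ℝ} {H : ℕ} (hN : 0 < N) (hH : 0 < H) (hγ : 0 < γ)
    (X : Param d × (Fin N → Param d)) :
    ‖X‖ ^ 2 ≤ (1 + N / (γ ^ 2 * (H : ℝ) ^ 2)) * lambdaNormSq γ H X := by
  have hS : 0 ≤ ∑ c, ‖X.2 c‖ ^ 2 := by positivity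
  have h2 : ‖X.2‖ ^ 2 ≤ ∑ c, ‖X.2 c‖ ^ 2 := by
    have : ‖X.2‖ ≤ √(∑ c, ‖X.2 c‖ ^ 2) := by
      refine (pi_norm_le_iff_of_nonneg (Real.sqrt_nonneg _)).2 fun c => Real.le_sqrt_of_sq_le ?_
      exact Finset.single_le_sum (f := fun c => ‖X.2 c‖ ^ 2) (fun _ _ => sq_nonneg _)
        (Finset.mem_univ c)
    calc _ ≤ √(∑ c, ‖X.2 c‖ ^ 2) ^ 2 := by gcongr
      _ = _ := Real.sq_sqrt hS
  have h1 : ‖X‖ ^ 2 ≤ ‖X.1‖ ^ 2 + ‖X.2‖ ^ 2 := by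
    rw [Prod.norm_def]
    rcases max_cases ‖X.1‖ ‖X.2‖ with h | h <;> rw [h.1] <;> nlinarith [sq_nonneg ‖X.1‖, sq_nonneg ‖X.2‖]
  have hN' : (0 : ℝ) < N := by exact_mod_cast hN
  have hH' : (0 : ℝ) < H := by exact_mod_cast hH
  have h3 : (1 + N / (γ ^ 2 * (H : ℝ) ^ 2)) * lambdaNormSq γ H X
      = ‖X.1‖ ^ 2 + ∑ c, ‖X.2 c‖ ^ 2 + N / (γ ^ 2 * (H : ℝ) ^ 2) * ‖X.1‖ ^ 2
        + γ ^ 2 * (H : ℝ) ^ 2 / (N : ℝ) * ∑ c, ‖X.2 c‖ ^ 2 := by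
    unfold lambdaNormSq; field_simp; ring
  rw [h3]
  have h4 : 0 ≤ N / (γ ^ 2 * (H : ℝ) ^ 2) * ‖X.1‖ ^ 2 := by positivity
  have h5 : 0 ≤ γ ^ 2 * (H : ℝ) ^ 2 / (N : ℝ) * ∑ c, ‖X.2 c‖ ^ 2 := by positivity
  linarith

/-- Pythagoras: the deviations from the mean sum to zero, hence are orthogonal to it. -/
theorem norm_average_sq_add_sum_sub_average_sq {E : Type*} [NormedAddCommGroup E]
    [InnerProductSpace ℝ E] (hN : 0 < N) (a : Fin N → E) :
    ‖(1 / (N : ℝ)) • ∑ c, a c‖ ^ 2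
      + 1 / (N : ℝ) * ∑ c, ‖a c - (1 / (N : ℝ)) • ∑ c', a c'‖ ^ 2
      = 1 / (N : ℝ) * ∑ c, ‖a c‖ ^ 2 := by
  have hN' : (N : ℝ) ≠ 0 := by positivity
  set m := (1 / (N : ℝ)) • ∑ c, a c with hm
  have hs : ∑ c, a c = (N : ℝ) • m := by rw [hm, smul_smul, mul_one_div_cancel hN', one_smul]
  have h1 : ∑ c, ‖a c - m‖ ^ 2 = ∑ c, ‖a c‖ ^ 2 - N * ‖m‖ ^ 2 := by
    simp only [norm_sub_sq_real, Finset.sum_add_distrib, Finset.sum_sub_distrib, ← Finset.mul_sum,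
      ← sum_inner, hs, inner_smul_left, real_inner_self_eq_norm_sq]
    simp
    ring
  rw [h1]
  field_simp
  ring

end LambdaNorm

/-! ### One communication round -/

section Update

variable {Z : Type*} {d N : ℕ} {F : Fin N → Z → Param d → ℝ}

/-- Because control variates sum to zero, the corrections vanish in the average and the global
difference is the mean of the `a c`. The control difference of a client is its deviation from that
mean divided by `γH`, so the weight `γ²H²/N` makes the control part the variance of `a`. -/
theorem lambdaNormSq_update_sub_update {γ : ℝ} {H : ℕ} (hN : 0 < N) (hH : 0 < H) (hγ : 0 < γ)
    (X Y : State N d) (z : Fin N → Fin H → Z) :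
    lambdaNormSq γ H ((update F γ H X z).1 - (update F γ H Y z).1)
      = 1 / (N : ℝ) * ∑ c, ‖localIterate (F c) γ X.1.1 (X.1.2 c) H (z c)
        - localIterate (F c) γ Y.1.1 (Y.1.2 c) H (z c) + (γ * H) • (X.1.2 c - Y.1.2 c)‖ ^ 2 := by
  have hH' : (H : ℝ) ≠ 0 := by positivity
  set a : Fin N → Param d := fun c => localIterate (F c) γ X.1.1 (X.1.2 c) H (z c)
        - localIterate (F c) γ Y.1.1 (Y.1.2 c) H (z c) + (γ * H) • (X.1.2 c - Y.1.2 c) with ha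
  have hg : globalUpdate F γ H X.1 z - globalUpdate F γ H Y.1 z = (1 / (N : ℝ)) • ∑ c, a c := by
    simp only [ha, globalUpdate, Finset.sum_add_distrib, Finset.sum_sub_distrib, ← Finset.smul_sum,
      X.2, Y.2, sub_zero, smul_zero, add_zero, smul_sub]
  have hc : ∀ c, controlUpdate F γ H X.1 z c - controlUpdate F γ H Y.1 z c
      = (1 / (γ * H)) • (a c - (1 / (N : ℝ)) • ∑ c', a c') := by
    intro c
    rw [← hg]
    simp only [controlUpdate, ha]
    have : X.1.2 c - Y.1.2 c = (1 / (γ * H)) • (γ * H) • (X.1.2 c - Y.1.2 c) := by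
      rw [smul_smul, one_div_mul_cancel (by positivity), one_smul]
    calc _ = (X.1.2 c - Y.1.2 c) + (1 / (γ * H)) • (localIterate (F c) γ X.1.1 (X.1.2 c) H (z c)
        - localIterate (F c) γ Y.1.1 (Y.1.2 c) H (z c)
        - (globalUpdate F γ H X.1 z - globalUpdate F γ H Y.1 z)) := by module
      _ = _ := by
        conv_lhs => rw [this]
        module
  rw [← norm_average_sq_add_sum_sub_average_sq hN a]
  simp only [lambdaNormSq, update, Prod.fst_sub, Prod.snd_sub, Pi.sub_apply, hg, hc, norm_smul,
    mul_pow, ← Finset.mul_sum]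
  rw [Real.norm_of_nonneg (by positivity : 0 ≤ 1 / (γ * H))]
  field_simp

theorem continuous_update {γ : ℝ} {H : ℕ} (hG : ∀ c z, Continuous (gradient (F c z)))
    (z : Fin N → Fin H → Z) : Continuous fun X : State N d => update F γ H X z := by
  have h1 : ∀ c, Continuous fun X : State N d =>
      localIterate (F c) γ X.1.1 (X.1.2 c) H (z c) := fun c =>
    (continuous_localIterate (γ := γ) (hG c) H (z c)).comp
      (g := fun p : Param d × Param d => localIterate (F c) γ p.1 p.2 H (z c))
      (f := fun X : State N d => (X.1.1, X.1.2 c)) (by fun_prop)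
  have h2 : Continuous fun X : State N d => globalUpdate F γ H X.1 z :=
    (continuous_finsetSum _ fun c _ => h1 c).const_smul (1 / (N : ℝ))
  refine Continuous.subtype_mk (h2.prodMk (continuous_pi fun c => ?_)) _
  exact (by fun_prop : Continuous fun X : State N d => X.1.2 c).add
    (((h1 c).sub h2).const_smul (1 / (γ * H)))

variable [MeasurableSpace Z]

theorem measurable_update {γ : ℝ} {H : ℕ}
    (hG : ∀ c, Measurable fun p : Param d × Z => gradient (F c p.2) p.1) :
    Measurable fun p : State N d × (Fin N → Fin H → Z) => update F γ H p.1 p.2 := by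
  have h0 : ∀ c, Measurable fun p : State N d × (Fin N → Fin H → Z) => p.1.1.2 c := fun c =>
    (measurable_pi_apply c).comp (measurable_snd.comp (measurable_subtype_coe.comp measurable_fst))
  have h1 : ∀ c, Measurable fun p : State N d × (Fin N → Fin H → Z) =>
      localIterate (F c) γ p.1.1.1 (p.1.1.2 c) H (p.2 c) := fun c =>
    (measurable_localIterate (γ := γ) (hG c) H).comp
      (g := fun p : (Param d × Param d) × (Fin H → Z) => localIterate (F c) γ p.1.1 p.1.2 H p.2)
      (f := fun p : State N d × (Fin N → Fin H → Z) => ((p.1.1.1, p.1.1.2 c), p.2 c))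
      (((measurable_fst.comp (measurable_subtype_coe.comp measurable_fst)).prodMk (h0 c)).prodMk
        ((measurable_pi_apply c).comp measurable_snd))
  have h2 : Measurable fun p : State N d × (Fin N → Fin H → Z) => globalUpdate F γ H p.1.1 p.2 :=
    (Finset.measurable_sum _ fun c _ => h1 c).const_smul (1 / (N : ℝ))
  refine Measurable.subtype_mk (h2.prodMk (measurable_pi_lambda _ fun c => ?_))
  exact (h0 c).add (((h1 c).sub h2).const_smul (1 / (γ * H)))

variable {ν : Fin N → Measure Z} [∀ c, IsProbabilityMeasure (ν c)]

instance isProbabilityMeasure_noiseLaw (H : ℕ) : IsProbabilityMeasure (noiseLaw ν H) := by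
  unfold noiseLaw; infer_instance

/-- Each client's bound involves only its own observations; the average over clients of the
right-hand sides is exactly the squared `Λ`-norm of `X - Y`. -/
theorem lintegral_lambdaNormSq_update_sub_le {μ L γ : ℝ} {H : ℕ} (hN : 0 < N) (hH : 0 < H)
    (hL0 : 0 < L) (hμ : 0 < μ) (hγ : 0 < γ) (hγL : γ * L ≤ 1 / 2) (hγH : γ * H * (L + μ) ≤ 1)
    (hρ0 : 0 ≤ 1 - γ * μ / 4)
    (hm : ∀ c θ, Measurable fun z => F c z θ) (hi : ∀ c θ, Integrable (fun z => F c z θ) (ν c))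
    (hd : ∀ c z, Differentiable ℝ (F c z)) (hc : ∀ c z, ConvexOn ℝ Set.univ (F c z))
    (hL : ∀ c z θ θ', ‖gradient (F c z) θ - gradient (F c z) θ'‖ ≤ L * ‖θ - θ'‖)
    (hg : ∀ c θ, Integrable (fun z => gradient (F c z) θ) (ν c))
    (hs : ∀ c, StrongConvexOn Set.univ μ (localRisk (F c) (ν c))) (X Y : State N d) :
    ∫⁻ z, ENNReal.ofReal (lambdaNormSq γ H ((update F γ H X z).1 - (update F γ H Y z).1))
        ∂(noiseLaw ν H)
      ≤ ENNReal.ofReal ((1 - γ * μ / 4) ^ H) * ENNReal.ofReal (lambdaNormSq γ H (X.1 - Y.1)) := by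
  set u : (c : Fin N) → (Fin H → Z) → ℝ := fun c w =>
    ‖localIterate (F c) γ X.1.1 (X.1.2 c) H w - localIterate (F c) γ Y.1.1 (Y.1.2 c) H w
      + (γ * H) • (X.1.2 c - Y.1.2 c)‖ ^ 2 with hu
  have hu0 : ∀ c w, 0 ≤ u c w := fun c w => sq_nonneg _
  have hum : ∀ c, Measurable fun w => ENNReal.ofReal (u c w) := fun c => by
    have hG := measurable_gradient_uncurry (hm c) (hd c) (hL c)
    exact ((((measurable_localIterate_comp hG _ _ measurable_id).sub
      (measurable_localIterate_comp hG _ _ measurable_id)).add_const _).norm.pow_const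
      2).ennreal_ofReal
  have hbound : ∀ c, ∫⁻ z : Fin N → Fin H → Z, ENNReal.ofReal (u c (z c)) ∂(noiseLaw ν H)
      ≤ ENNReal.ofReal ((1 - γ * μ / 4) ^ H * (‖X.1.1 - Y.1.1‖ ^ 2
        + γ ^ 2 * (H : ℝ) ^ 2 * ‖X.1.2 c - Y.1.2 c‖ ^ 2)) := fun c => by
    have h1 : ∫⁻ z : Fin N → Fin H → Z, ENNReal.ofReal (u c (z c)) ∂(noiseLaw ν H)
        = ∫⁻ w, ENNReal.ofReal (u c w) ∂(Measure.pi fun _ : Fin H => ν c) :=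
      (measurePreserving_eval (fun c => Measure.pi fun _ : Fin H => ν c) c).lintegral_comp (hum c)
    rw [h1]
    exact lintegral_localIterate_sub_le_pow_mul hL0 hμ hγ hγL (hm c) (hi c) (hd c) (hc c) (hL c)
      (hg c) (hs c) _ _ _ _ hH hγH
  calc _ = ∫⁻ z : Fin N → Fin H → Z, ENNReal.ofReal (1 / (N : ℝ)) * ∑ c, ENNReal.ofReal (u c (z c))
        ∂(noiseLaw ν H) := by
        refine lintegral_congr fun z => ?_
        rw [lambdaNormSq_update_sub_update hN hH hγ, ENNReal.ofReal_mul (by positivity),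
          ENNReal.ofReal_sum_of_nonneg fun c _ => hu0 c (z c)]
    _ = ENNReal.ofReal (1 / (N : ℝ)) * ∑ c, ∫⁻ z : Fin N → Fin H → Z, ENNReal.ofReal (u c (z c)) ∂(noiseLaw ν H) := by
        have : ∀ c, Measurable fun z : Fin N → Fin H → Z => ENNReal.ofReal (u c (z c)) :=
          fun c => (hum c).comp (measurable_pi_apply c)
        rw [lintegral_const_mul _ (Finset.measurable_fun_sum _ fun c _ => this c),
          lintegral_finsetSum _ fun c _ => this c]
    _ ≤ ENNReal.ofReal (1 / (N : ℝ)) * ∑ c, ENNReal.ofReal ((1 - γ * μ / 4) ^ H *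
        (‖X.1.1 - Y.1.1‖ ^ 2 + γ ^ 2 * (H : ℝ) ^ 2 * ‖X.1.2 c - Y.1.2 c‖ ^ 2)) := by
        gcongr with c
        exact hbound c
    _ = _ := by
        rw [← ENNReal.ofReal_sum_of_nonneg fun c _ =>
            mul_nonneg (pow_nonneg hρ0 _) (by positivity),
          ← ENNReal.ofReal_mul (by positivity), ← ENNReal.ofReal_mul (pow_nonneg hρ0 _),
          ← Finset.mul_sum, Finset.sum_add_distrib, ← Finset.mul_sum]
        congr 1
        have hN' : (N : ℝ) ≠ 0 := by positivity
        simp only [lambdaNormSq, Finset.sum_const, Finset.card_univ, Fintype.card_fin, nsmul_eq_mul,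
          Prod.fst_sub, Prod.snd_sub, Pi.sub_apply]
        field_simp

theorem lintegral_lambdaNormSq_update_lt_top {L γ : ℝ} {H : ℕ}
    (hG : ∀ c, Measurable fun p : Param d × Z => gradient (F c p.2) p.1)
    (hL : ∀ c z θ θ', ‖gradient (F c z) θ - gradient (F c z) θ'‖ ≤ L * ‖θ - θ'‖)
    (hg : ∀ c, MemLp (fun z => gradient (F c z) 0) 2 (ν c)) (X : State N d) :
    ∫⁻ z, ENNReal.ofReal (lambdaNormSq γ H (update F γ H X z).1) ∂(noiseLaw ν H) < ∞ := by
  have h1 : ∀ c, MemLp (fun z : Fin N → Fin H → Z =>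
      localIterate (F c) γ X.1.1 (X.1.2 c) H (z c)) 2 (noiseLaw ν H) := fun c =>
    memLp_localIterate (hG c) (hL c) _ _ H (ζ := fun i (z : Fin N → Fin H → Z) => z c i)
      (fun i => (measurable_pi_apply i).comp (measurable_pi_apply c)) fun i =>
      (hg c).comp_measurePreserving ((measurePreserving_eval (fun _ : Fin H => ν c) i).comp
        (measurePreserving_eval (fun c => Measure.pi fun _ : Fin H => ν c) c))
  have h2 : MemLp (fun z : Fin N → Fin H → Z => globalUpdate F γ H X.1 z) 2 (noiseLaw ν H) :=
    (memLp_finsetSum _ fun c _ => h1 c).const_smul (1 / (N : ℝ))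
  have h3 : ∀ c, MemLp (fun z : Fin N → Fin H → Z => controlUpdate F γ H X.1 z c) 2
      (noiseLaw ν H) := fun c =>
    (memLp_const (X.1.2 c)).add (((h1 c).sub h2).const_smul (1 / (γ * H)))
  refine Integrable.lintegral_lt_top ?_
  exact (h2.integrable_norm_pow two_ne_zero).add
    ((integrable_finsetSum _ fun c _ => (h3 c).integrable_norm_pow two_ne_zero).const_mul _)

end Update

/-! ### Backward iteration of random maps -/

section RandomIteration

/-- It suffices that the inverse map, prepending an independent entry, preserves the measure; this
is checked on cylinders. -/
theorem measurePreserving_head_tail {W : Type*} [MeasurableSpace W] (m : Measure W)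
    [IsProbabilityMeasure m] :
    MeasurePreserving (fun w : ℕ → W => (w 0, fun k => w (k + 1)))
      (Measure.infinitePi fun _ : ℕ => m) (m.prod (Measure.infinitePi fun _ : ℕ => m)) := by
  set Q := Measure.infinitePi fun _ : ℕ => m with hQ
  have hf : Measurable fun w : ℕ → W => (w 0, fun k => w (k + 1)) := by fun_prop
  let cons : W × (ℕ → W) → ℕ → W := fun p n => Nat.casesOn n p.1 p.2
  have hcons : Measurable cons := by
    refine measurable_pi_lambda _ fun n => ?_
    cases n with
    | zero => exact measurable_fst
    | succ n => exact (measurable_pi_apply n).comp measurable_snd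
  have hmap : (m.prod Q).map cons = Q := by
    refine Measure.eq_infinitePi _ fun s t ht => ?_
    classical
    have h1 : MeasurableSet (Set.pi (s : Set ℕ) t) :=
      MeasurableSet.pi s.countable_toSet fun i _ => ht i
    set s' : Finset ℕ := s.preimage Nat.succ Nat.succ_injective.injOn with hs'
    -- The head is unconstrained when `0 ∉ s`; its factor then has mass one.
    have h2 : cons ⁻¹' (Set.pi (s : Set ℕ) t) = (if 0 ∈ s then t 0 else Set.univ) ×ˢ
        (Set.pi (s' : Set ℕ) fun k => t (k + 1)) := by
      ext ⟨a, w⟩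
      simp only [Set.mem_preimage, Set.mem_pi, Finset.mem_coe, Set.mem_prod, hs',
        Finset.mem_preimage]
      constructor
      · intro h
        refine ⟨?_, fun k hk => h (k + 1) hk⟩
        split_ifs with h0
        · exact h 0 h0
        · trivial
      · rintro ⟨h0, h⟩ n hn
        cases n with
        | zero => rwa [if_pos hn] at h0
        | succ n => exact h n hn
    rw [Measure.map_apply hcons h1, h2, Measure.prod_prod, hQ,
      Measure.infinitePi_pi _ (fun i _ => ht (i + 1))]
    have h3 : ∏ k ∈ s', m (t (k + 1)) = ∏ i ∈ s.erase 0, m (t i) := by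
      refine Finset.prod_bij (fun k _ => k + 1) (fun k hk => ?_) (fun _ _ _ _ h => by simpa using h)
        (fun i hi => ?_) (fun _ _ => rfl)
      · simpa [hs'] using hk
      · obtain ⟨hi0, his⟩ := Finset.mem_erase.1 hi
        exact ⟨i - 1, by simpa [hs', Nat.sub_add_cancel (Nat.one_le_iff_ne_zero.2 hi0)] using his,
          Nat.sub_add_cancel (Nat.one_le_iff_ne_zero.2 hi0)⟩
    rw [h3]
    split_ifs with h0
    · exact Finset.mul_prod_erase s (fun i => m (t i)) h0
    · rw [measure_univ, one_mul, Finset.erase_eq_of_notMem h0]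
  refine ⟨hf, ?_⟩
  rw [← hmap, Measure.map_map hf hcons, hmap]
  exact Measure.map_id

/-- The backward iterates `φ_{w 0} ∘ ⋯ ∘ φ_{w (n-1)}` of a random map. -/
def backwardIterate {S W : Type*} (φ : S → W → S) (x : S) : ℕ → (ℕ → W) → S
  | 0, _ => x
  | n + 1, w => φ (backwardIterate φ x n fun k => w (k + 1)) (w 0)

variable {S W : Type*} [MeasurableSpace S] [MeasurableSpace W] {φ : S → W → S}
  {m : Measure W}

theorem measurable_backwardIterate (hφ : Measurable (Function.uncurry φ)) (n : ℕ) :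
    Measurable fun p : S × (ℕ → W) => backwardIterate φ p.1 n p.2 := by
  induction n with
  | zero => exact measurable_fst
  | succ n ih =>
    have h1 := ih.comp (f := fun p : S × (ℕ → W) => (p.1, fun k => p.2 (k + 1))) (by fun_prop)
    have h2 : Measurable fun p : S × (ℕ → W) => p.2 0 :=
      (measurable_pi_apply 0).comp measurable_snd
    exact hφ.comp (h1.prodMk h2)

theorem measurable_backwardIterate_right (hφ : Measurable (Function.uncurry φ)) (n : ℕ) (x : S) :
    Measurable (backwardIterate φ x n) :=
  (measurable_backwardIterate hφ n).comp (measurable_const.prodMk measurable_id)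

theorem lintegral_bind_eq {K : Kernel S S} (hφ : Measurable (Function.uncurry φ))
    (hK : ∀ x, K x = m.map (φ x)) (ρ : Measure S) {f : S → ℝ≥0∞} (hf : Measurable f) :
    ∫⁻ y, f y ∂(ρ.bind ⇑K) = ∫⁻ x, ∫⁻ a, f (φ x a) ∂m ∂ρ := by
  rw [Measure.lintegral_bind K.measurable.aemeasurable hf.aemeasurable]
  refine lintegral_congr fun x => ?_
  have hφx : Measurable (φ x) := hφ.comp measurable_prodMk_left
  rw [hK, lintegral_map hf hφx]

variable [IsProbabilityMeasure m]

theorem lintegral_infinitePi_head_tail {G : W → (ℕ → W) → ℝ≥0∞}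
    (hG : Measurable (Function.uncurry G)) :
    ∫⁻ w, G (w 0) (fun k => w (k + 1)) ∂(Measure.infinitePi fun _ : ℕ => m)
      = ∫⁻ w, ∫⁻ a, G a w ∂m ∂(Measure.infinitePi fun _ : ℕ => m) := by
  have h1 := (measurePreserving_head_tail m).lintegral_comp hG
  rw [lintegral_prod_symm _ hG.aemeasurable] at h1
  exact h1

/-- The outermost map uses only `w 0`, which is independent of the tail driving the inner iterates,
so it can be averaged out alone. Two starting points and two depths are allowed in order to compare
iterates. -/
theorem lintegral_backwardIterate_succ (hφ : Measurable (Function.uncurry φ)) (n : ℕ) (x y : S)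
    {n' : ℕ} {G : S → S → ℝ≥0∞} (hG : Measurable (Function.uncurry G)) :
    ∫⁻ w, G (backwardIterate φ x (n + 1) w) (backwardIterate φ y (n' + 1) w)
        ∂(Measure.infinitePi fun _ : ℕ => m)
      = ∫⁻ w, ∫⁻ a, G (φ (backwardIterate φ x n w) a) (φ (backwardIterate φ y n' w) a) ∂m
        ∂(Measure.infinitePi fun _ : ℕ => m) := by
  refine lintegral_infinitePi_head_tail (m := m)
    (G := fun a w => G (φ (backwardIterate φ x n w) a) (φ (backwardIterate φ y n' w) a)) ?_
  have h1 : Measurable fun p : W × (ℕ → W) => φ (backwardIterate φ x n p.2) p.1 :=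
    hφ.comp (((measurable_backwardIterate_right hφ n x).comp measurable_snd).prodMk measurable_fst)
  have h2 : Measurable fun p : W × (ℕ → W) => φ (backwardIterate φ y n' p.2) p.1 :=
    hφ.comp (((measurable_backwardIterate_right hφ n' y).comp measurable_snd).prodMk measurable_fst)
  exact hG.comp (h1.prodMk h2)

/-- The two iterates share their `n` outermost maps, and each of these costs a factor `r`; the `k`
innermost maps remain. -/
theorem lintegral_backwardIterate_le {D : S → S → ℝ≥0∞} (hφ : Measurable (Function.uncurry φ))
    (hD : Measurable (Function.uncurry D)) {r : ℝ≥0∞}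
    (hr : ∀ x y, ∫⁻ a, D (φ x a) (φ y a) ∂m ≤ r * D x y) (n k : ℕ) (x y : S) :
    ∫⁻ w, D (backwardIterate φ x (n + k) w) (backwardIterate φ y n w)
        ∂(Measure.infinitePi fun _ : ℕ => m)
      ≤ r ^ n * ∫⁻ w, D (backwardIterate φ x k w) y ∂(Measure.infinitePi fun _ : ℕ => m) := by
  induction n with
  | zero => simp [backwardIterate]
  | succ n ih =>
    rw [show n + 1 + k = (n + k) + 1 by ring, lintegral_backwardIterate_succ hφ _ _ _ hD]
    refine (lintegral_mono fun w => hr _ _).trans ?_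
    have hDm : Measurable fun w => D (backwardIterate φ x (n + k) w) (backwardIterate φ y n w) :=
      hD.comp ((measurable_backwardIterate_right hφ _ x).prodMk
        (measurable_backwardIterate_right hφ n y))
    rw [lintegral_const_mul _ hDm, pow_succ', mul_assoc]
    gcongr

/-- By Cauchy–Schwarz the mean of `e n` is at most `(CA)^(1/2) (r^(1/2))^n`, so the sum has finite
expectation. -/
theorem ae_tsum_ne_top_of_sq_le {Ω : Type*} [MeasurableSpace Ω] {P : Measure Ω}
    [IsProbabilityMeasure P] {e G : ℕ → Ω → ℝ≥0∞} (he : ∀ n, Measurable (e n))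
    {C A r : ℝ≥0∞} (hC : C ≠ ∞) (hA : A ≠ ∞) (hr : r < 1)
    (heG : ∀ n ω, e n ω ^ 2 ≤ C * G n ω) (hG : ∀ n, ∫⁻ ω, G n ω ∂P ≤ r ^ n * A) :
    ∀ᵐ ω ∂P, ∑' n, e n ω ≠ ∞ := by
  set q : ℝ≥0∞ := r ^ (1 / 2 : ℝ) with hq
  have hq1 : q < 1 := ENNReal.rpow_lt_one hr (by norm_num)
  have h1 : ∀ n, ∫⁻ ω, e n ω ∂P ≤ (C * A) ^ (1 / 2 : ℝ) * q ^ n := by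
    intro n
    have h2 : ∫⁻ ω, e n ω ^ 2 ∂P ≤ C * A * r ^ n := by
      refine (lintegral_mono (heG n)).trans ?_
      rw [lintegral_const_mul' _ _ hC, mul_assoc, mul_comm A]
      exact mul_le_mul_right (hG n) C
    have h3 := eLpNorm_le_eLpNorm_of_exponent_le (p := 1) (q := 2) one_le_two
      (he n).aestronglyMeasurable (μ := P)
    rw [eLpNorm_one_eq_lintegral_enorm,
      eLpNorm_eq_lintegral_rpow_enorm_toReal two_ne_zero ENNReal.ofNat_ne_top] at h3
    simp only [enorm_eq_self, ENNReal.toReal_ofNat, ENNReal.rpow_ofNat] at h3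
    refine h3.trans ((ENNReal.rpow_le_rpow h2 (by norm_num)).trans (le_of_eq ?_))
    rw [ENNReal.mul_rpow_of_nonneg _ _ (by norm_num), hq, ← ENNReal.rpow_natCast,
      ← ENNReal.rpow_natCast, ← ENNReal.rpow_mul, ← ENNReal.rpow_mul, mul_comm (n : ℝ)]
  have h4 : ∫⁻ ω, ∑' n, e n ω ∂P ≠ ∞ := by
    rw [lintegral_tsum fun n => (he n).aemeasurable]
    refine ne_top_of_le_ne_top ?_ (ENNReal.tsum_le_tsum h1)
    rw [ENNReal.tsum_mul_left, ENNReal.tsum_geometric]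
    refine ENNReal.mul_ne_top (ENNReal.rpow_ne_top_of_nonneg (by norm_num)
      (ENNReal.mul_ne_top hC hA)) (ENNReal.inv_ne_top.2 (tsub_pos_of_lt hq1).ne')
  filter_upwards [ae_lt_top (Measurable.tsum he) h4] with ω hω using hω.ne

end RandomIteration

/-! ### Existence, uniqueness and moments of the stationary law -/

section Stationary

variable {S W : Type*} [MetricSpace S] [CompleteSpace S] [SecondCountableTopology S]
  [MeasurableSpace S] [BorelSpace S] [MeasurableSpace W] {φ : S → W → S}
  {m : Measure W} [IsProbabilityMeasure m]

/-- A random map that is continuous and contracts a cost `D` in expectation has a unique stationary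
distribution, which has a finite moment for every Lyapunov function. -/
theorem exists_invariant_of_contraction {K : Kernel S S} {D : S → S → ℝ≥0∞} {V : S → ℝ≥0∞}
    {r s b C : ℝ≥0∞} (x₀ : S) (hφ : Measurable (Function.uncurry φ))
    (hφc : ∀ a, Continuous fun x => φ x a) (hK : ∀ x, K x = m.map (φ x))
    (hD : Measurable (Function.uncurry D)) (hr : r < 1)
    (hDr : ∀ x y, ∫⁻ a, D (φ x a) (φ y a) ∂m ≤ r * D x y)
    (hC : C ≠ ∞) (hDC : ∀ x y, edist x y ^ 2 ≤ C * D x y)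
    (hV : Continuous V) (hVtop : ∀ x, V x ≠ ∞) (hs : s < 1) (hb : b ≠ ∞)
    (hVs : ∀ x, ∫⁻ a, V (φ x a) ∂m ≤ s * V x + b) (hDV : ∀ x y, D x y ≤ 2 * V x + 2 * V y) :
    ∃ π : Measure S, IsProbabilityMeasure π ∧ Kernel.Invariant K π ∧
      (∀ π' : Measure S, IsProbabilityMeasure π' → Kernel.Invariant K π' → π' = π) ∧
      ∫⁻ x, V x ∂π < ∞ := by
  set Q := Measure.infinitePi fun _ : ℕ => m with hQ
  have hB := fun n x => measurable_backwardIterate_right hφ n x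
  have hBV : ∀ n x, Measurable fun w => V (backwardIterate φ x n w) :=
    fun n x => hV.measurable.comp (hB n x)
  have hDtop : ∀ x y, D x y ≠ ∞ := fun x y => ne_top_of_le_ne_top
    (ENNReal.add_ne_top.2 ⟨ENNReal.mul_ne_top ENNReal.ofNat_ne_top (hVtop x),
      ENNReal.mul_ne_top ENNReal.ofNat_ne_top (hVtop y)⟩) (hDV x y)
  have hsb : ∀ x, s * V x + b ≠ ∞ := fun x =>
    ENNReal.add_ne_top.2 ⟨ENNReal.mul_ne_top hs.ne_top (hVtop x), hb⟩
  -- Consecutive backward iterates differ only in the innermost map, so their distances are almost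
  -- surely summable. Forward iterates would converge only in law.
  have hcauchy : ∀ᵐ w ∂Q, ∃ y, Tendsto (fun n => backwardIterate φ x₀ n w) atTop (𝓝 y) := by
    have h1 := ae_tsum_ne_top_of_sq_le (P := Q)
      (e := fun n w => edist (backwardIterate φ x₀ (n + 1) w) (backwardIterate φ x₀ n w))
      (G := fun n w => D (backwardIterate φ x₀ (n + 1) w) (backwardIterate φ x₀ n w))
      (fun n => (hB _ _).edist (hB _ _)) hC
      (A := ∫⁻ w, D (backwardIterate φ x₀ 1 w) x₀ ∂Q) ?_ hr (fun n w => hDC _ _)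
      (fun n => lintegral_backwardIterate_le hφ hD hDr n 1 x₀ x₀)
    · filter_upwards [h1] with w hw
      refine cauchySeq_tendsto_of_complete (cauchySeq_of_edist_le_of_tsum_ne_top _ (fun n => ?_) hw)
      rw [edist_comm]
    · have h2 : ∫⁻ w, V (backwardIterate φ x₀ 1 w) ∂Q ≤ s * V x₀ + b := by
        have h3 := lintegral_backwardIterate_succ (m := m) hφ 0 x₀ x₀ (n' := 0)
          (G := fun x _ => V x) (hV.measurable.comp measurable_fst)
        rw [h3]
        simp only [backwardIterate, lintegral_const, measure_univ, mul_one]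
        exact hVs x₀
      refine ne_top_of_le_ne_top ?_ (lintegral_mono fun w => hDV _ _)
      rw [lintegral_add_right _ measurable_const, lintegral_const, measure_univ, mul_one,
        lintegral_const_mul _ (hBV 1 x₀)]
      exact ENNReal.add_ne_top.2 ⟨ENNReal.mul_ne_top ENNReal.ofNat_ne_top
        (ne_top_of_le_ne_top (hsb x₀) h2), ENNReal.mul_ne_top ENNReal.ofNat_ne_top (hVtop x₀)⟩
  obtain ⟨Y, hY, hYlim⟩ := measurable_limit_of_tendsto_metrizable_ae
    (fun n => (hB n x₀).aemeasurable) hcauchy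
  -- Orbits from two starting points merge, so the limit forgets the start; uniqueness rests on
  -- this.
  have hYlim' : ∀ x, ∀ᵐ w ∂Q, Tendsto (fun n => backwardIterate φ x n w) atTop (𝓝 (Y w)) := by
    intro x
    have h1 := ae_tsum_ne_top_of_sq_le (P := Q)
      (e := fun n w => edist (backwardIterate φ x n w) (backwardIterate φ x₀ n w))
      (G := fun n w => D (backwardIterate φ x n w) (backwardIterate φ x₀ n w))
      (fun n => (hB _ _).edist (hB _ _)) hC (A := D x x₀) (hDtop _ _) hr (fun n w => hDC _ _)
      (fun n => by simpa [backwardIterate] using lintegral_backwardIterate_le hφ hD hDr n 0 x x₀)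
    filter_upwards [h1, hYlim] with w hw hw'
    rw [tendsto_iff_edist_tendsto_0] at hw' ⊢
    have h2 := (ENNReal.tendsto_atTop_zero_of_tsum_ne_top hw).add hw'
    rw [add_zero] at h2
    exact tendsto_of_tendsto_of_tendsto_of_le_of_le tendsto_const_nhds h2 (fun _ => zero_le)
      fun n => edist_triangle _ _ _
  have hmp := measurePreserving_head_tail m
  have hshift : MeasurePreserving (fun w : ℕ → W => fun k => w (k + 1)) Q Q :=
    measurePreserving_snd.comp hmp
  -- Passing to the limit in the recursion by continuity of the map: `Y` is the image under `w 0` of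
  -- its own shifted copy, independent of `w 0`. This makes its law invariant.
  have hfix : ∀ᵐ w ∂Q, Y w = φ (Y fun k => w (k + 1)) (w 0) := by
    filter_upwards [hYlim, hshift.quasiMeasurePreserving.ae hYlim] with w h1 h2
    exact tendsto_nhds_unique (h1.comp (tendsto_add_atTop_nat 1))
      (((hφc (w 0)).tendsto _).comp h2)
  have hπlint : ∀ f : S → ℝ≥0∞, Measurable f → ∫⁻ x, f x ∂(Q.map Y) = ∫⁻ w, f (Y w) ∂Q :=
    fun f hf => lintegral_map hf hY
  -- Iterating the drift inequality with the geometric series; `(1 - s)⁻¹` solves `c = s * c + 1`.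
  have hVlint : ∀ n, ∫⁻ w, V (backwardIterate φ x₀ n w) ∂Q ≤ V x₀ + b * (1 - s)⁻¹ := by
    intro n
    induction n with
    | zero => simp [backwardIterate]
    | succ n ih =>
      have h3 := lintegral_backwardIterate_succ (m := m) hφ n x₀ x₀ (n' := 0)
        (G := fun x _ => V x) (hV.measurable.comp measurable_fst)
      rw [h3]
      refine (lintegral_mono fun w => hVs _).trans ?_
      rw [lintegral_add_right _ measurable_const, lintegral_const, measure_univ, mul_one,
        lintegral_const_mul _ (hBV n x₀)]
      have h4 : (1 - s)⁻¹ = s * (1 - s)⁻¹ + 1 := by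
        have h5 : 1 - s ≠ 0 := (tsub_pos_of_lt hs).ne'
        calc (1 - s)⁻¹ = (s + (1 - s)) * (1 - s)⁻¹ := by rw [add_tsub_cancel_of_le hs.le, one_mul]
          _ = _ := by
            rw [add_mul, ENNReal.mul_inv_cancel h5
              (ne_top_of_le_ne_top ENNReal.one_ne_top tsub_le_self)]
      calc s * ∫⁻ w, V (backwardIterate φ x₀ n w) ∂Q + b ≤ s * (V x₀ + b * (1 - s)⁻¹) + b := by
            gcongr
        _ = s * V x₀ + b * (s * (1 - s)⁻¹ + 1) := by ring
        _ ≤ 1 * V x₀ + b * (1 - s)⁻¹ := by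
            rw [← h4]
            gcongr
        _ = _ := by rw [one_mul]
  refine ⟨Q.map Y, Measure.isProbabilityMeasure_map hY.aemeasurable, ?_, ?_, ?_⟩
  · refine Measure.ext_of_lintegral _ fun f hf => ?_
    rw [lintegral_bind_eq hφ hK _ hf,
      hπlint _ (Measurable.lintegral_prod_right' (f := fun p : S × W => f (φ p.1 p.2)) (hf.comp hφ)),
      hπlint _ hf]
    have hG : Measurable (Function.uncurry fun a w => f (φ (Y w) a)) :=
      hf.comp (hφ.comp ((hY.comp measurable_snd).prodMk measurable_fst))
    rw [hQ, ← lintegral_infinitePi_head_tail (m := m) hG]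
    refine lintegral_congr_ae ?_
    filter_upwards [hfix] with w hw
    rw [← hw]
  · intro π' hπ' hinv
    have : IsProbabilityMeasure (Q.map Y) := Measure.isProbabilityMeasure_map hY.aemeasurable
    -- Backward and forward iterates have the same law at a fixed time, so an invariant law is
    -- preserved. Letting `n → ∞` against bounded continuous functions identifies it with the law of
    -- `Y`.
    have hstat : ∀ n, ∀ f : S → ℝ≥0∞, Measurable f →
        ∫⁻ x, ∫⁻ w, f (backwardIterate φ x n w) ∂Q ∂π' = ∫⁻ x, f x ∂π' := by
      intro n
      induction n with
      | zero => intro f hf; simp [backwardIterate]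
      | succ n ih =>
        intro f hf
        have h3 := fun x => lintegral_backwardIterate_succ (m := m) hφ n x x (n' := 0)
          (G := fun x _ => f x) (hf.comp measurable_fst)
        have hf' : Measurable fun x => ∫⁻ a, f (φ x a) ∂m :=
          Measurable.lintegral_prod_right' (f := fun p : S × W => f (φ p.1 p.2)) (hf.comp hφ)
        simp only [hQ]
        simp only [h3]
        rw [ih _ hf', ← lintegral_bind_eq hφ hK _ hf, hinv]
    refine ext_of_forall_lintegral_eq_of_IsFiniteMeasure fun f => ?_
    have hfm : Measurable fun x => (f x : ℝ≥0∞) := f.continuous.measurable.coe_nnreal_ennreal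
    have hbd : ∀ x, (f x : ℝ≥0∞) ≤ nndist 0 f := fun x =>
      ENNReal.coe_le_coe.2 (f.apply_le_nndist_zero x)
    have h1 : ∀ x, Tendsto (fun n => ∫⁻ w, f (backwardIterate φ x n w) ∂Q) atTop
        (𝓝 (∫⁻ w, f (Y w) ∂Q)) := by
      intro x
      refine tendsto_lintegral_of_dominated_convergence (fun _ => (nndist 0 f : ℝ≥0∞))
        (fun n => hfm.comp (hB n x)) (fun n => Eventually.of_forall fun w => hbd _) (by simp) ?_
      filter_upwards [hYlim' x] with w hw
      exact ENNReal.tendsto_coe.2 ((f.continuous.tendsto _).comp hw)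
    have h2 : Tendsto (fun n => ∫⁻ x, ∫⁻ w, f (backwardIterate φ x n w) ∂Q ∂π') atTop
        (𝓝 (∫⁻ _, ∫⁻ w, f (Y w) ∂Q ∂π')) := by
      refine tendsto_lintegral_of_dominated_convergence (fun _ => (nndist 0 f : ℝ≥0∞))
        (fun n => ?_) (fun n => Eventually.of_forall fun x => ?_) (by simp)
        (Eventually.of_forall h1)
      · exact Measurable.lintegral_prod_right'
          (f := fun p : S × (ℕ → W) => (f (backwardIterate φ p.1 n p.2) : ℝ≥0∞))
          (hfm.comp (measurable_backwardIterate hφ n))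
      · refine (lintegral_mono fun w => hbd _).trans ?_
        simp
    simp only [fun n => hstat n _ hfm, lintegral_const, measure_univ, mul_one] at h2
    rw [hπlint _ hfm]
    exact tendsto_nhds_unique tendsto_const_nhds h2
  · rw [hπlint _ hV.measurable]
    refine lt_of_le_of_lt ?_ (b := V x₀ + b * (1 - s)⁻¹) ?_
    -- Fatou's lemma transfers the uniform moment bound to the limit.
    · calc ∫⁻ w, V (Y w) ∂Q = ∫⁻ w, liminf (fun n => V (backwardIterate φ x₀ n w)) atTop ∂Q := by
            refine lintegral_congr_ae ?_
            filter_upwards [hYlim] with w hw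
            exact (((hV.tendsto _).comp hw).liminf_eq).symm
        _ ≤ liminf (fun n => ∫⁻ w, V (backwardIterate φ x₀ n w) ∂Q) atTop :=
            lintegral_liminf_le fun n => hV.measurable.comp (hB n x₀)
        _ ≤ V x₀ + b * (1 - s)⁻¹ := by
            refine (liminf_le_liminf (Eventually.of_forall hVlint)).trans ?_
            simp
    · exact (ENNReal.add_ne_top.2 ⟨hVtop x₀, ENNReal.mul_ne_top hb
        (ENNReal.inv_ne_top.2 (tsub_pos_of_lt hs).ne')⟩).lt_top

end Stationary

/-! ### Synchronous coupling -/

section Coupling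

variable {S W : Type*} [MeasurableSpace S] [MeasurableSpace W] {φ : S → W → S}
  {m : Measure W} [IsProbabilityMeasure m]

/-- Running a random map with common noise on both components of a coupling. -/
theorem exists_coupling_bind_lintegral_le {K : Kernel S S} {D : S → S → ℝ≥0∞} {r : ℝ≥0∞}
    (hφ : Measurable (Function.uncurry φ)) (hK : ∀ x, K x = m.map (φ x))
    (hD : Measurable (Function.uncurry D))
    (hDr : ∀ x y, ∫⁻ a, D (φ x a) (φ y a) ∂m ≤ r * D x y) (ξ : Measure (S × S)) [SFinite ξ] :
    ∃ ξ' : Measure (S × S), ξ'.map Prod.fst = (ξ.map Prod.fst).bind ⇑K ∧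
      ξ'.map Prod.snd = (ξ.map Prod.snd).bind ⇑K ∧
      ∫⁻ p, D p.1 p.2 ∂ξ' ≤ r * ∫⁻ p, D p.1 p.2 ∂ξ := by
  have h1 : Measurable fun q : (S × S) × W => φ q.1.1 q.2 :=
    hφ.comp (measurable_fst.fst.prodMk measurable_snd)
  have h2 : Measurable fun q : (S × S) × W => φ q.1.2 q.2 :=
    hφ.comp (measurable_fst.snd.prodMk measurable_snd)
  -- Both components are moved by the same noise `q.2`, independent of the pair.
  refine ⟨(ξ.prod m).map fun q => (φ q.1.1 q.2, φ q.1.2 q.2), ?_, ?_, ?_⟩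
  · refine Measure.ext_of_lintegral _ fun f hf => ?_
    have hf' : Measurable fun x => ∫⁻ a, f (φ x a) ∂m :=
      Measurable.lintegral_prod_right' (f := fun p : S × W => f (φ p.1 p.2)) (hf.comp hφ)
    have hf1 : Measurable fun p : S × S => f p.1 := hf.comp measurable_fst
    have hfh : Measurable fun q : (S × S) × W => f (φ q.1.1 q.2) := hf.comp h1
    rw [lintegral_bind_eq hφ hK _ hf, lintegral_map hf' measurable_fst,
      lintegral_map hf measurable_fst, lintegral_map hf1 (h1.prodMk h2),
      lintegral_prod _ hfh.aemeasurable]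
  · refine Measure.ext_of_lintegral _ fun f hf => ?_
    have hf' : Measurable fun x => ∫⁻ a, f (φ x a) ∂m :=
      Measurable.lintegral_prod_right' (f := fun p : S × W => f (φ p.1 p.2)) (hf.comp hφ)
    have hf2 : Measurable fun p : S × S => f p.2 := hf.comp measurable_snd
    have hfh : Measurable fun q : (S × S) × W => f (φ q.1.2 q.2) := hf.comp h2
    rw [lintegral_bind_eq hφ hK _ hf, lintegral_map hf' measurable_snd,
      lintegral_map hf measurable_snd, lintegral_map hf2 (h1.prodMk h2),
      lintegral_prod _ hfh.aemeasurable]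
  · have hD1 : Measurable fun p : S × S => D p.1 p.2 := hD
    have hD2 : Measurable fun q : (S × S) × W => D (φ q.1.1 q.2) (φ q.1.2 q.2) :=
      hD.comp (h1.prodMk h2)
    rw [lintegral_map hD1 (h1.prodMk h2), lintegral_prod _ hD2.aemeasurable,
      ← lintegral_const_mul _ hD1]
    exact lintegral_mono fun p => hDr p.1 p.2

end Coupling

/-! ### Independence and joint laws -/

section Independence

variable {Ω : Type*} [MeasurableSpace Ω] {P : Measure Ω} [IsProbabilityMeasure P]

/-- Both hypotheses together say that the joint law of `X`, `A`, `B` is a triple product, which may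
be bracketed either way. -/
theorem IndepFun.prodMk_left_of_prodMk_right {α β γ : Type*} [MeasurableSpace α] [MeasurableSpace β]
    [MeasurableSpace γ] {X : Ω → α} {A : Ω → β} {B : Ω → γ} (hX : Measurable X) (hA : Measurable A)
    (hB : Measurable B) (h : IndepFun X (fun ω => (A ω, B ω)) P) (hAB : IndepFun A B P) :
    IndepFun (fun ω => (X ω, A ω)) B P := by
  have hXA : IndepFun X A P := h.comp measurable_id measurable_fst
  have e1 := h.map_prod_eq_prod_map_map hX.aemeasurable (hA.prodMk hB).aemeasurable
  rw [hAB.map_prod_eq_prod_map_map hA.aemeasurable hB.aemeasurable] at e1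
  rw [indepFun_iff_map_prod_eq_prod_map_map (hX.prodMk hA).aemeasurable hB.aemeasurable,
    hXA.map_prod_eq_prod_map_map hX.aemeasurable hA.aemeasurable]
  have : IsProbabilityMeasure (P.map X) := Measure.isProbabilityMeasure_map hX.aemeasurable
  have : IsProbabilityMeasure (P.map A) := Measure.isProbabilityMeasure_map hA.aemeasurable
  have : IsProbabilityMeasure (P.map B) := Measure.isProbabilityMeasure_map hB.aemeasurable
  apply MeasurableEquiv.prodAssoc.map_measurableEquiv_injective
  rw [Measure.prodAssoc_prod, ← e1,
    Measure.map_map MeasurableEquiv.prodAssoc.measurable ((hX.prodMk hA).prodMk hB)]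
  rfl

theorem lintegral_of_indepFun {α W : Type*} [MeasurableSpace α] [MeasurableSpace W] {m : Measure W}
    [IsProbabilityMeasure m] {A : Ω → α} {B : Ω → W} (hA : Measurable A) (hB : Measurable B)
    (hAB : IndepFun A B P) (hm : P.map B = m) {G : α → W → ℝ≥0∞}
    (hG : Measurable (Function.uncurry G)) :
    ∫⁻ ω, G (A ω) (B ω) ∂P = ∫⁻ ω, ∫⁻ a, G (A ω) a ∂m ∂P := by
  have h1 := lintegral_map (μ := P) hG (hA.prodMk hB)
  rw [hAB.map_prod_eq_prod_map_map hA.aemeasurable hB.aemeasurable, hm,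
    lintegral_prod _ hG.aemeasurable, lintegral_map hG.lintegral_prod_right' hA] at h1
  exact h1.symm

theorem map_eq_pi_pi_of_iIndepFun {ι κ Z : Type*} [Fintype ι] [Fintype κ] [MeasurableSpace Z]
    {ν : ι → Measure Z} [∀ i, IsProbabilityMeasure (ν i)] {ζ : ι → κ → Ω → Z}
    (hζ : ∀ i k, Measurable (ζ i k)) (hlaw : ∀ i k, P.map (ζ i k) = ν i)
    (hind : iIndepFun (fun p : ι × κ => ζ p.1 p.2) P) :
    P.map (fun ω i k => ζ i k ω) = Measure.pi fun i => Measure.pi fun _ : κ => ν i := by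
  have h1 := (iIndepFun_iff_map_fun_eq_pi_map (fun p : ι × κ => (hζ p.1 p.2).aemeasurable)).1 hind
  simp only [hlaw] at h1
  have h2 := Measure.infinitePi_map_curry (fun (i : ι) (_ : κ) => ν i)
  simp only [Measure.infinitePi_eq_pi] at h2
  have h3 : Measurable fun ω (p : ι × κ) => ζ p.1 p.2 ω :=
    measurable_pi_lambda _ fun p => hζ p.1 p.2
  rw [← h1, Measure.map_map (MeasurableEquiv.measurable _) h3] at h2
  exact h2

end Independence

theorem bind_pow_zero {S : Type*} [MeasurableSpace S] (K : Kernel S S) (ρ : Measure S) :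
    ρ.bind ⇑(K ^ 0) = ρ := by
  rw [pow_zero]
  exact Measure.id_comp

theorem bind_pow_succ {S : Type*} [MeasurableSpace S] (K : Kernel S S) (ρ : Measure S) (t : ℕ) :
    ρ.bind ⇑(K ^ (t + 1)) = (ρ.bind ⇑(K ^ t)).bind ⇑K := by
  rw [pow_succ']
  exact Measure.comp_assoc.symm

/-! ### Markov property of recursions driven by independent noise -/

section RandomRecursion

variable {Ω : Type*} [MeasurableSpace Ω] {P : Measure Ω} [IsProbabilityMeasure P]
  {S W : Type*} [MeasurableSpace S] [MeasurableSpace W] {φ : S → W → S} {m : Measure W}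
  {X : ℕ → Ω → S} {η : ℕ → Ω → W}

theorem measurable_of_recursion (hφ : Measurable (Function.uncurry φ)) (h0 : Measurable (X 0))
    (hη : ∀ t, Measurable (η t)) (hstep : ∀ t ω, X (t + 1) ω = φ (X t ω) (η t ω)) (t : ℕ) :
    Measurable (X t) := by
  induction t with
  | zero => exact h0
  | succ t ih =>
    rw [funext (hstep t)]
    exact hφ.comp (ih.prodMk (hη t))

/-- In a recursion driven by independent noise, the noise of a step is independent of the past. -/
theorem indepFun_history_of_iIndepFun {κ Z : Type*} [Fintype κ] [MeasurableSpace Z]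
    {ψ : S → (κ → Z) → S} {ζ : ℕ × κ → Ω → Z} (hψ : Measurable (Function.uncurry ψ))
    (h0 : Measurable (X 0)) (hζ : ∀ i, Measurable (ζ i)) (hind : iIndepFun ζ P)
    (hind0 : IndepFun (X 0) (fun ω i => ζ i ω) P)
    (hstep : ∀ t ω, X (t + 1) ω = ψ (X t ω) (fun k => ζ (t, k) ω)) (t : ℕ) :
    IndepFun (fun ω (s : Fin (t + 1)) => X s ω) (fun ω k => ζ (t, k) ω) P := by
  classical
  -- `I` indexes the observations before round `t`, `J` those of round `t`.
  let I : Finset (ℕ × κ) := Finset.range t ×ˢ Finset.univ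
  let J : Finset (ℕ × κ) := {t} ×ˢ Finset.univ
  have hmemI : ∀ s k, s < t → (s, k) ∈ I := fun s k hs => by simpa [I] using hs
  have hmemJ : ∀ k, (t, k) ∈ J := fun k => by simp [J]
  have hIJ : Disjoint I J := by
    rw [Finset.disjoint_left]
    intro p hp hq
    simp only [I, J, Finset.mem_product, Finset.mem_range, Finset.mem_singleton] at hp hq
    omega
  have hAB : IndepFun (fun ω (i : I) => ζ i ω) (fun ω (i : J) => ζ i ω) P :=
    hind.indepFun_finset I J hIJ hζ
  have hXAB : IndepFun (X 0) (fun ω => ((fun i : I => ζ i ω), (fun i : J => ζ i ω))) P :=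
    hind0.comp (φ := id) (ψ := fun w : ℕ × κ → Z => ((fun i : I => w i), (fun i : J => w i)))
      measurable_id (by fun_prop)
  have hXA := IndepFun.prodMk_left_of_prodMk_right h0 (measurable_pi_lambda _ fun i => hζ _)
    (measurable_pi_lambda _ fun i => hζ _) hXAB hAB
  -- The states up to time `t` are measurable functions of `X 0` and the observations in `I`, a pair
  -- independent of those in `J`.
  have hfactor : ∀ s, s ≤ t → ∃ g : S × (I → Z) → S, Measurable g ∧
      ∀ ω, X s ω = g (X 0 ω, fun i => ζ i ω) := by
    intro s
    induction s with
    | zero => exact fun _ => ⟨Prod.fst, measurable_fst, fun _ => rfl⟩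
    | succ s ih =>
      intro hs
      obtain ⟨g, hg, hgX⟩ := ih (by omega)
      refine ⟨fun p => ψ (g p) (fun k => p.2 ⟨(s, k), hmemI s k hs⟩), ?_, fun ω => ?_⟩
      · have h1 : Measurable fun (p : S × (I → Z)) k => p.2 ⟨(s, k), hmemI s k hs⟩ := by fun_prop
        exact hψ.comp (hg.prodMk h1)
      · simp only [hstep, hgX]
  choose g hg hgX using hfactor
  have h1 : (fun ω (s : Fin (t + 1)) => X s ω)
      = (fun p (s : Fin (t + 1)) => g s (Nat.lt_succ_iff.1 s.2) p) ∘ fun ω => (X 0 ω, fun i : I => ζ i ω) := by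
    funext ω s
    exact hgX s (Nat.lt_succ_iff.1 s.2) ω
  have h2 : (fun ω k => ζ (t, k) ω)
      = (fun (w : J → Z) k => w ⟨(t, k), hmemJ k⟩) ∘ fun ω (i : J) => ζ i ω := rfl
  rw [h1, h2]
  exact hXA.comp (measurable_pi_lambda _ fun s => hg s (Nat.lt_succ_iff.1 s.2)) (by fun_prop)

variable [IsProbabilityMeasure m] {K : Kernel S S}

/-- The noise is independent of the history and can be integrated out first, which replaces the
indicator of `A` by `K (X t) A`. Varying `C` characterises the conditional law; `C = univ` gives the
marginal law. -/
theorem measure_history_inter_eq_setLIntegral (hφ : Measurable (Function.uncurry φ))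
    (hK : ∀ x, K x = m.map (φ x)) (h0 : Measurable (X 0)) (hη : ∀ t, Measurable (η t))
    (hlaw : ∀ t, P.map (η t) = m) (hstep : ∀ t ω, X (t + 1) ω = φ (X t ω) (η t ω))
    (hind : ∀ t, IndepFun (fun ω (s : Fin (t + 1)) => X s ω) (η t) P) (t : ℕ)
    {C : Set (Fin (t + 1) → S)} (hC : MeasurableSet C) {A : Set S} (hA : MeasurableSet A) :
    P ((fun ω (s : Fin (t + 1)) => X s ω) ⁻¹' C ∩ X (t + 1) ⁻¹' A)
      = ∫⁻ ω in (fun ω (s : Fin (t + 1)) => X s ω) ⁻¹' C, K (X t ω) A ∂P := by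
  have hm := measurable_of_recursion hφ h0 hη hstep
  have hhist : Measurable fun ω (s : Fin (t + 1)) => X s ω :=
    measurable_pi_lambda _ fun s => hm s
  have hlast : Measurable fun p : (Fin (t + 1) → S) × W => φ (p.1 (Fin.last t)) p.2 :=
    hφ.comp (f := fun p : (Fin (t + 1) → S) × W => (p.1 (Fin.last t), p.2)) (by fun_prop)
  have hA1 : Measurable (A.indicator (1 : S → ℝ≥0∞)) := measurable_one.indicator hA
  have hC1 : Measurable (C.indicator (1 : (Fin (t + 1) → S) → ℝ≥0∞)) := measurable_one.indicator hC
  have h1 := lintegral_of_indepFun (m := m) hhist (hη t) (hind t) (hlaw t)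
    (G := fun x z => C.indicator 1 x * A.indicator 1 (φ (x (Fin.last t)) z))
    ((hC1.comp measurable_fst).mul (hA1.comp hlast))
  rw [← lintegral_indicator_one ((hhist hC).inter (hm (t + 1) hA)),
    ← lintegral_indicator (hhist hC)]
  refine (lintegral_congr fun ω => ?_).trans (h1.trans (lintegral_congr fun ω => ?_))
  · rw [Set.inter_indicator_one, Pi.mul_apply]
    simp only [Fin.val_last, ← hstep t ω]
    rfl
  · have hu : Measurable (φ (X t ω)) := hφ.comp measurable_prodMk_left
    have h2 : ∫⁻ a, A.indicator 1 (φ (X t ω) a) ∂m = K (X t ω) A := by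
      rw [hK, Measure.map_apply hu hA, ← lintegral_indicator_one (hu hA)]
      rfl
    have h3 : Measurable fun a => A.indicator (1 : S → ℝ≥0∞) (φ (X t ω) a) := hA1.comp hu
    simp only [Fin.val_last]
    rw [lintegral_const_mul _ h3, h2]
    by_cases hω : (fun s : Fin (t + 1) => X s ω) ∈ C
    · rw [Set.indicator_of_mem hω, Set.indicator_of_mem (by exact hω), Pi.one_apply, one_mul]
    · rw [Set.indicator_of_notMem hω, Set.indicator_of_notMem (by exact hω), zero_mul]

theorem isMarkovChain_of_recursion [IsMarkovKernel K] (hφ : Measurable (Function.uncurry φ))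
    (hK : ∀ x, K x = m.map (φ x)) (h0 : Measurable (X 0)) (hη : ∀ t, Measurable (η t))
    (hlaw : ∀ t, P.map (η t) = m) (hstep : ∀ t ω, X (t + 1) ω = φ (X t ω) (η t ω))
    (hind : ∀ t, IndepFun (fun ω (s : Fin (t + 1)) => X s ω) (η t) P) :
    IsMarkovChain P K X := by
  have hm := measurable_of_recursion hφ h0 hη hstep
  refine ⟨hm, fun t A hA => ?_⟩
  have hhist : Measurable fun ω (s : Fin (t + 1)) => X s ω :=
    measurable_pi_lambda _ fun s => hm s
  have hKA : Measurable fun x => K x A := K.measurable_coe hA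
  have hint : Integrable (fun ω => (K (X t ω)).real A) P :=
    Integrable.of_bound (C := 1) (hKA.comp (hm t)).ennreal_toReal.aestronglyMeasurable
      (Eventually.of_forall fun ω => by
        rw [Real.norm_of_nonneg measureReal_nonneg]; exact measureReal_le_one)
  symm
  refine ae_eq_condExp_of_forall_setIntegral_eq hhist.comap_le
    ((integrable_const _).indicator (hm (t + 1) hA)) (fun s _ _ => hint.integrableOn) ?_ ?_
  · rintro _ ⟨C, hC, rfl⟩ _
    rw [integral_indicator_const _ (hm (t + 1) hA), smul_eq_mul, mul_one, measureReal_def,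
      Measure.restrict_apply (hm (t + 1) hA), Set.inter_comm,
      measure_history_inter_eq_setLIntegral hφ hK h0 hη hlaw hstep hind t hC hA]
    exact integral_toReal (hKA.comp (hm t)).aemeasurable
      (Eventually.of_forall fun ω => measure_lt_top _ _)
  · have h1 : Measurable fun x : Fin (t + 1) → S => (K (x (Fin.last t))).real A :=
      (hKA.comp (measurable_pi_apply _)).ennreal_toReal
    exact (h1.comp (comap_measurable _)).aestronglyMeasurable

theorem map_eq_bind_pow_of_recursion (hφ : Measurable (Function.uncurry φ))
    (hK : ∀ x, K x = m.map (φ x)) (h0 : Measurable (X 0)) (hη : ∀ t, Measurable (η t))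
    (hlaw : ∀ t, P.map (η t) = m) (hstep : ∀ t ω, X (t + 1) ω = φ (X t ω) (η t ω))
    (hind : ∀ t, IndepFun (fun ω (s : Fin (t + 1)) => X s ω) (η t) P) (t : ℕ) :
    P.map (X t) = (P.map (X 0)).bind ⇑(K ^ t) := by
  have hm := measurable_of_recursion hφ h0 hη hstep
  induction t with
  | zero => rw [bind_pow_zero]
  | succ t ih =>
    rw [bind_pow_succ, ← ih]
    ext A hA
    have h1 := measure_history_inter_eq_setLIntegral hφ hK h0 hη hlaw hstep hind t
      MeasurableSet.univ hA
    rw [Set.preimage_univ, Set.univ_inter, Measure.restrict_univ] at h1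
    rw [Measure.map_apply (hm _) hA, h1, Measure.bind_apply hA K.measurable.aemeasurable,
      lintegral_map (K.measurable_coe hA) (hm t)]

end RandomRecursion

/-! ### The iterates of the algorithm as a Markov chain -/

section Chain

variable {Z : Type*} [MeasurableSpace Z] {d N H : ℕ} {F : Fin N → Z → Param d → ℝ}
  {ν : Fin N → Measure Z} {γ : ℝ} {Ω : Type*} [MeasurableSpace Ω] {P : Measure Ω}
  [IsProbabilityMeasure P] {ρ : Measure (State N d)} {ζ : ℕ → Fin N → Fin H → Ω → Z}
  {X : ℕ → Ω → State N d}

theorem IsIterates.indepFun_history_obs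
    (hup : Measurable (Function.uncurry (update F γ H : State N d → _ → _)))
    (hX : IsIterates P F ν γ H ρ ζ X) (t : ℕ) :
    IndepFun (fun ω (s : Fin (t + 1)) => X s ω) (fun ω c h => ζ t c h ω) P := by
  have h1 := indepFun_history_of_iIndepFun
    (ψ := fun (x : State N d) (w : Fin N × Fin H → Z) => update F γ H x fun c h => w (c, h))
    (ζ := fun (i : ℕ × Fin N × Fin H) => ζ i.1 i.2.1 i.2.2)
    (hup.comp (f := fun p : State N d × (Fin N × Fin H → Z) => (p.1, fun c h => p.2 (c, h)))
      (by fun_prop))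
    hX.measurable_init (fun i => hX.measurable_obs _ _ _) hX.indep_obs hX.indep_init hX.step t
  exact h1.comp measurable_id (ψ := fun (w : Fin N × Fin H → Z) c h => w (c, h)) (by fun_prop)

variable [∀ c, IsProbabilityMeasure (ν c)]

theorem IsIterates.map_obs_eq (hX : IsIterates P F ν γ H ρ ζ X) (t : ℕ) :
    P.map (fun ω c h => ζ t c h ω) = noiseLaw ν H :=
  map_eq_pi_pi_of_iIndepFun (hX.measurable_obs t) (hX.law_obs t)
    (hX.indep_obs.precomp (g := fun p : Fin N × Fin H => (t, p.1, p.2))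
      fun p q h => by simpa [Prod.ext_iff] using h)

theorem IsIterates.isMarkovChain_and_map_eq {K : Kernel (State N d) (State N d)} [IsMarkovKernel K]
    (hup : Measurable (Function.uncurry (update F γ H : State N d → _ → _)))
    (hK : ∀ X, K X = transition F ν γ H X) (hX : IsIterates P F ν γ H ρ ζ X) :
    IsMarkovChain P K X ∧ ∀ t, P.map (X t) = ρ.bind ⇑(K ^ t) := by
  have hη : ∀ t, Measurable fun ω c h => ζ t c h ω := fun t =>
    measurable_pi_lambda _ fun c => measurable_pi_lambda _ fun h => hX.measurable_obs t c h
  refine ⟨isMarkovChain_of_recursion hup hK hX.measurable_init hη hX.map_obs_eq hX.step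
    (hX.indepFun_history_obs hup), fun t => ?_⟩
  rw [← hX.law_init]
  exact map_eq_bind_pow_of_recursion hup hK hX.measurable_init hη hX.map_obs_eq hX.step
    (hX.indepFun_history_obs hup) t

end Chain

theorem lintegral_prod_two_mul_add {S : Type*} [MeasurableSpace S] {ρ₁ ρ₂ : Measure S}
    [IsProbabilityMeasure ρ₁] [IsProbabilityMeasure ρ₂] {V : S → ℝ≥0∞} (hV : Measurable V) :
    ∫⁻ p, (2 * V p.1 + 2 * V p.2) ∂(ρ₁.prod ρ₂) = 2 * ∫⁻ x, V x ∂ρ₁ + 2 * ∫⁻ x, V x ∂ρ₂ := by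
  have hV1 : Measurable fun p : S × S => V p.1 := hV.comp measurable_fst
  have hV2 : Measurable fun p : S × S => V p.2 := hV.comp measurable_snd
  rw [lintegral_add_left (hV1.const_mul 2), lintegral_const_mul _ hV1, lintegral_const_mul _ hV2,
    lintegral_prod _ hV1.aemeasurable, lintegral_prod _ hV2.aemeasurable]
  simp only [lintegral_const, measure_univ, mul_one]

/-- The image of `x` is compared with that of a reference point `y` under the same noise; for fixed
`y` the last term is a constant, and a drift inequality results. -/
theorem lintegral_le_of_contraction {S W : Type*} [MeasurableSpace S] [MeasurableSpace W]
    {φ : S → W → S} {m : Measure W} {D : S → S → ℝ≥0∞} {V : S → ℝ≥0∞} {k k' r : ℝ≥0∞}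
    (hφ : Measurable (Function.uncurry φ)) (hD : Measurable (Function.uncurry D))
    (hV : Measurable V) (hr : ∀ x y, ∫⁻ a, D (φ x a) (φ y a) ∂m ≤ r * D x y)
    (hVD : ∀ x y, V x ≤ k * D x y + k' * V y) (x y : S) :
    ∫⁻ a, V (φ x a) ∂m ≤ k * (r * D x y) + k' * ∫⁻ a, V (φ y a) ∂m := by
  have hφx : ∀ x, Measurable (φ x) := fun x => hφ.comp measurable_prodMk_left
  have hm1 : Measurable fun a => D (φ x a) (φ y a) := hD.comp ((hφx x).prodMk (hφx y))
  have hm2 : Measurable fun a => V (φ y a) := hV.comp (hφx y)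
  refine (lintegral_mono fun a => hVD (φ x a) (φ y a)).trans ?_
  rw [lintegral_add_left (hm1.const_mul _), lintegral_const_mul _ hm1, lintegral_const_mul _ hm2]
  gcongr
  exact hr x y

/-! ### Costs and Wasserstein distance on the state space -/

section StateSpace

variable {d N : ℕ}

instance completeSpace_state : CompleteSpace (State N d) := by
  have hc : IsClosed {X : Param d × (Fin N → Param d) | ∑ c, X.2 c = 0} :=
    isClosed_eq (by fun_prop) continuous_const
  exact hc.completeSpace_coe

theorem measurable_ofReal_lambdaNormSq_sub (γ : ℝ) (H : ℕ) :
    Measurable (Function.uncurry fun X Y : State N d =>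
      ENNReal.ofReal (lambdaNormSq γ H (X.1 - Y.1))) := by
  have : Continuous fun p : State N d × State N d => lambdaNormSq γ H (p.1.1 - p.2.1) :=
    (continuous_lambdaNormSq γ H).comp (by fun_prop)
  exact this.measurable.ennreal_ofReal

theorem continuous_ofReal_lambdaNormSq (γ : ℝ) (H : ℕ) :
    Continuous fun X : State N d => ENNReal.ofReal (lambdaNormSq γ H X.1) :=
  ENNReal.continuous_ofReal.comp ((continuous_lambdaNormSq γ H).comp continuous_subtype_val)

theorem ofReal_lambdaNormSq_sub_le (γ : ℝ) (H : ℕ) (X Y : State N d) :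
    ENNReal.ofReal (lambdaNormSq γ H (X.1 - Y.1))
      ≤ 2 * ENNReal.ofReal (lambdaNormSq γ H X.1) + 2 * ENNReal.ofReal (lambdaNormSq γ H Y.1) := by
  have hX := lambdaNormSq_nonneg γ H X.1
  have hY := lambdaNormSq_nonneg γ H Y.1
  refine (ENNReal.ofReal_le_ofReal (lambdaNormSq_sub_le γ H X.1 Y.1)).trans (le_of_eq ?_)
  rw [ENNReal.ofReal_add (by positivity) (by positivity), ENNReal.ofReal_mul zero_le_two,
    ENNReal.ofReal_mul zero_le_two, ENNReal.ofReal_ofNat]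

theorem ofReal_lambdaNormSq_le {γ : ℝ} {H : ℕ} {ε : ℝ} (hε : 0 < ε) (X Y : State N d) :
    ENNReal.ofReal (lambdaNormSq γ H X.1)
      ≤ ENNReal.ofReal (1 + ε) * ENNReal.ofReal (lambdaNormSq γ H (X.1 - Y.1))
        + ENNReal.ofReal (1 + 1 / ε) * ENNReal.ofReal (lambdaNormSq γ H Y.1) := by
  have h1 := lambdaNormSq_nonneg γ H (X.1 - Y.1)
  have h2 := lambdaNormSq_nonneg γ H Y.1
  rw [← ENNReal.ofReal_mul (by positivity), ← ENNReal.ofReal_mul (by positivity),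
    ← ENNReal.ofReal_add (by positivity) (by positivity)]
  have h3 := lambdaNormSq_add_le (γ := γ) (H := H) hε (X.1 - Y.1) Y.1
  rw [sub_add_cancel] at h3
  exact ENNReal.ofReal_le_ofReal h3

theorem edist_sq_le_mul_lambdaNormSq {γ : ℝ} {H : ℕ} (hN : 0 < N) (hH : 0 < H) (hγ : 0 < γ)
    (X Y : State N d) :
    edist X Y ^ 2 ≤ ENNReal.ofReal (1 + N / (γ ^ 2 * (H : ℝ) ^ 2))
      * ENNReal.ofReal (lambdaNormSq γ H (X.1 - Y.1)) := by
  rw [← ENNReal.ofReal_mul (by positivity), edist_dist, Subtype.dist_eq, dist_eq_norm,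
    ← ENNReal.ofReal_pow (norm_nonneg _)]
  exact ENNReal.ofReal_le_ofReal (norm_sq_le_mul_lambdaNormSq hN hH hγ _)

/-- Every coupling of the initial laws yields a coupling of their images with cost reduced by `r`.
That `r` is neither zero nor infinite lets it pass through the infimum. -/
theorem wassersteinSq_bind_le {W : Type*} [MeasurableSpace W] {φ : State N d → W → State N d}
    {m : Measure W} [IsProbabilityMeasure m] {K : Kernel (State N d) (State N d)} {γ : ℝ} {H : ℕ}
    {r : ℝ≥0∞} (hφ : Measurable (Function.uncurry φ)) (hK : ∀ x, K x = m.map (φ x))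
    (hr0 : r ≠ 0) (hrtop : r ≠ ∞)
    (hr : ∀ x y, ∫⁻ a, ENNReal.ofReal (lambdaNormSq γ H ((φ x a).1 - (φ y a).1)) ∂m
      ≤ r * ENNReal.ofReal (lambdaNormSq γ H (x.1 - y.1)))
    (ρ₁ ρ₂ : Measure (State N d)) [IsFiniteMeasure ρ₁] :
    wassersteinSq γ H (ρ₁.bind ⇑K) (ρ₂.bind ⇑K) ≤ r * wassersteinSq γ H ρ₁ ρ₂ := by
  unfold wassersteinSq
  rw [ENNReal.mul_iInf_of_ne hr0 hrtop]
  refine le_iInf fun ξ => ?_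
  rw [ENNReal.mul_iInf_of_ne hr0 hrtop]
  refine le_iInf fun hξ => ?_
  -- A coupling inherits its total mass from a marginal; finiteness permits the product with the
  -- noise law.
  have hfin : IsFiniteMeasure ξ := by
    have h1 : IsFiniteMeasure (ξ.map Prod.fst) := hξ.1 ▸ inferInstance
    exact (Measure.isFiniteMeasure_map_iff measurable_fst.aemeasurable).1 h1
  obtain ⟨ξ', h1, h2, h3⟩ := exists_coupling_bind_lintegral_le hφ hK
    (measurable_ofReal_lambdaNormSq_sub γ H) hr ξ
  rw [hξ.1] at h1
  rw [hξ.2] at h2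
  exact (iInf₂_le ξ' ⟨h1, h2⟩).trans h3

/-- The independent coupling has finite cost. -/
theorem wassersteinSq_lt_top (γ : ℝ) (H : ℕ) {ρ₁ ρ₂ : Measure (State N d)}
    [IsProbabilityMeasure ρ₁] [IsProbabilityMeasure ρ₂] (h1 : secondMoment γ H ρ₁ < ∞)
    (h2 : secondMoment γ H ρ₂ < ∞) : wassersteinSq γ H ρ₁ ρ₂ < ∞ := by
  have h3 : ∫⁻ p, ENNReal.ofReal (lambdaNormSq γ H (p.1.1 - p.2.1)) ∂(ρ₁.prod ρ₂)
      ≤ 2 * secondMoment γ H ρ₁ + 2 * secondMoment γ H ρ₂ := by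
    have h4 := lintegral_prod_two_mul_add (ρ₁ := ρ₁) (ρ₂ := ρ₂)
      (continuous_ofReal_lambdaNormSq (N := N) (d := d) γ H).measurable
    unfold secondMoment
    rw [← h4]
    exact lintegral_mono fun p => ofReal_lambdaNormSq_sub_le γ H p.1 p.2
  have hcoup : (ρ₁.prod ρ₂).map Prod.fst = ρ₁ ∧ (ρ₁.prod ρ₂).map Prod.snd = ρ₂ := by
    rw [Measure.map_fst_prod, Measure.map_snd_prod, measure_univ, measure_univ, one_smul, one_smul]
    exact ⟨rfl, rfl⟩
  unfold wassersteinSq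
  refine ((iInf₂_le (ρ₁.prod ρ₂) hcoup).trans h3).trans_lt ?_
  exact ENNReal.add_lt_top.2 ⟨ENNReal.mul_lt_top ENNReal.ofNat_lt_top h1,
    ENNReal.mul_lt_top ENNReal.ofNat_lt_top h2⟩

end StateSpace

/-- A contraction in expectation with a finite second moment at one point satisfies a drift
condition. -/
theorem exists_drift_of_contraction {d N : ℕ} {W : Type*} [MeasurableSpace W]
    {φ : State N d → W → State N d} {m : Measure W} [IsProbabilityMeasure m] {γ R : ℝ} {H : ℕ}
    (hφ : Measurable (Function.uncurry φ)) (hR0 : 0 < R) (hR1 : R < 1)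
    (hr : ∀ x y, ∫⁻ a, ENNReal.ofReal (lambdaNormSq γ H ((φ x a).1 - (φ y a).1)) ∂m
      ≤ ENNReal.ofReal R * ENNReal.ofReal (lambdaNormSq γ H (x.1 - y.1)))
    {x₀ : State N d} (hx₀ : x₀.1 = 0)
    (hfin : ∫⁻ a, ENNReal.ofReal (lambdaNormSq γ H (φ x₀ a).1) ∂m < ∞) :
    ∃ s b : ℝ≥0∞, s < 1 ∧ b ≠ ∞ ∧ ∀ x, ∫⁻ a, ENNReal.ofReal (lambdaNormSq γ H (φ x a).1) ∂m
      ≤ s * ENNReal.ofReal (lambdaNormSq γ H x.1) + b := by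
  -- Chosen so that `(1 + ε) R = (1 + R)/2`, halfway between `R` and `1`.
  set ε := (1 - R) / (2 * R) with hε
  have hε0 : 0 < ε := div_pos (by linarith) (by linarith)
  have hεR : (1 + ε) * R = (1 + R) / 2 := by rw [hε]; field_simp; ring
  refine ⟨ENNReal.ofReal ((1 + R) / 2), ENNReal.ofReal (1 + 1 / ε)
    * ∫⁻ a, ENNReal.ofReal (lambdaNormSq γ H (φ x₀ a).1) ∂m, ?_,
    ENNReal.mul_ne_top ENNReal.ofReal_ne_top hfin.ne, fun x => ?_⟩
  · rw [ENNReal.ofReal_lt_one]; linarith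
  have h1 := lintegral_le_of_contraction (k := ENNReal.ofReal (1 + ε))
    (k' := ENNReal.ofReal (1 + 1 / ε)) hφ (measurable_ofReal_lambdaNormSq_sub γ H)
    (continuous_ofReal_lambdaNormSq γ H).measurable hr (ofReal_lambdaNormSq_le hε0) x x₀
  rwa [← mul_assoc, ← ENNReal.ofReal_mul (by positivity), hεR, hx₀, sub_zero] at h1

theorem secondMoment_bind_pow_lt_top {d N : ℕ} {W : Type*} [MeasurableSpace W]
    {φ : State N d → W → State N d} {m : Measure W} {γ : ℝ} {H : ℕ}
    {K : Kernel (State N d) (State N d)} (hφ : Measurable (Function.uncurry φ))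
    (hK : ∀ x, K x = m.map (φ x)) {s b : ℝ≥0∞} (hs : s ≠ ∞) (hb : b ≠ ∞)
    (hdrift : ∀ x, ∫⁻ a, ENNReal.ofReal (lambdaNormSq γ H (φ x a).1) ∂m
      ≤ s * ENNReal.ofReal (lambdaNormSq γ H x.1) + b)
    [IsMarkovKernel K] {ρ : Measure (State N d)} [IsProbabilityMeasure ρ]
    (hρ : secondMoment γ H ρ < ∞) (t : ℕ) :
    IsProbabilityMeasure (ρ.bind ⇑(K ^ t)) ∧ secondMoment γ H (ρ.bind ⇑(K ^ t)) < ∞ := by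
  have hV := (continuous_ofReal_lambdaNormSq (N := N) (d := d) γ H).measurable
  induction t with
  | zero =>
    rw [bind_pow_zero]
    exact ⟨inferInstance, hρ⟩
  | succ t ih =>
    rw [bind_pow_succ]
    obtain ⟨hprob, ih⟩ := ih
    refine ⟨inferInstance, ?_⟩
    unfold secondMoment at ih ⊢
    rw [lintegral_bind_eq hφ hK _ hV]
    refine (lintegral_mono hdrift).trans_lt ?_
    rw [lintegral_add_right _ measurable_const, lintegral_const_mul _ hV, lintegral_const,
      measure_univ, mul_one]
    exact ENNReal.add_lt_top.2 ⟨ENNReal.mul_lt_top hs.lt_top ih, hb.lt_top⟩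

theorem measurable_transition {Z : Type*} [MeasurableSpace Z] {d N H : ℕ}
    {F : Fin N → Z → Param d → ℝ} {ν : Fin N → Measure Z} [∀ c, IsProbabilityMeasure (ν c)] {γ : ℝ}
    (hup : Measurable (Function.uncurry (update F γ H : State N d → _ → _))) :
    Measurable (transition F ν γ H) := by
  refine Measure.measurable_of_measurable_coe _ fun A hA => ?_
  have h1 : (fun X => transition F ν γ H X A)
      = fun X => noiseLaw ν H (Prod.mk X ⁻¹' (Function.uncurry (update F γ H) ⁻¹' A)) := by
    funext X
    have hX : Measurable (update F γ H X) := hup.comp measurable_prodMk_left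
    rw [transition, Measure.map_apply hX hA]
    rfl
  rw [h1]
  exact measurable_measure_prodMk_left (hup hA)

end Scaffold

/-! ### Assembly of the theorem -/

theorem theorem1 {Z : Type*} [MeasurableSpace Z] {d N H : ℕ} (hN : 0 < N) (hH : 0 < H)
    (F : Fin N → Z → Param d → ℝ) (ν : Fin N → Measure Z) [∀ c, IsProbabilityMeasure (ν c)]
    (hF_meas : ∀ c θ, Measurable fun z => F c z θ)
    (hF_int : ∀ c θ, Integrable (fun z => F c z θ) (ν c))
    {μ L γ : ℝ} (hμ : 0 < μ) (hL : 0 < L) (hγ : 0 < γ)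
    (θstar : Param d) (hθstar : ∀ θ, globalRisk F ν θstar ≤ globalRisk F ν θ)
    (h_strong : StrongConvexity F ν μ)
    (h_smooth : Smoothness F L)
    (h_convex : ∀ c z, ConvexOn ℝ Set.univ (F c z))
    (h_noise : NoiseMomentBound F ν θstar)
    (hγL : γ ≤ 1 / (2 * L)) (hγH : γ * H * (L + μ) ≤ 1) :
    ∃ K : Kernel (State N d) (State N d),
      IsMarkovKernel K ∧
      (∀ X, K X = transition F ν γ H X) ∧
      -- the iterates form a Markov chain with kernel `K`
      (∀ {Ω : Type*} [MeasurableSpace Ω] (P : Measure Ω) [IsProbabilityMeasure P]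
        (ρ : Measure (State N d)) (ζ : ℕ → Fin N → Fin H → Ω → Z) (X : ℕ → Ω → State N d),
        IsIterates P F ν γ H ρ ζ X →
          IsMarkovChain P K X ∧ ∀ t, P.map (X t) = ρ.bind ⇑(K ^ t)) ∧
      -- there is a unique stationary distribution, and it has a finite second moment
      ∃ π : Measure (State N d),
        IsProbabilityMeasure π ∧ Kernel.Invariant K π ∧
        (∀ π' : Measure (State N d), IsProbabilityMeasure π' → Kernel.Invariant K π' → π' = π) ∧
        secondMoment γ H π < ∞ ∧
        -- the laws of the iterates converge to it at a geometric rate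
        ∀ ρ : Measure (State N d), IsProbabilityMeasure ρ → secondMoment γ H ρ < ∞ →
          (∀ t, secondMoment γ H (ρ.bind ⇑(K ^ t)) < ∞) ∧
          wassersteinSq γ H ρ π < ∞ ∧
          Tendsto (fun t => wassersteinSq γ H (ρ.bind ⇑(K ^ t)) π) atTop (𝓝 0) ∧
          ∀ t : ℕ, wassersteinSq γ H (ρ.bind ⇑(K ^ t)) π
            ≤ ENNReal.ofReal ((1 - γ * μ / 4) ^ (H * t)) * wassersteinSq γ H ρ π := by
  have hγL' : γ * L ≤ 1 / 2 := by
    have := mul_le_mul_of_nonneg_right hγL hL.le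
    rwa [show 1 / (2 * L) * L = 1 / 2 by field_simp] at this
  have hH1 : (1 : ℝ) ≤ H := by exact_mod_cast hH
  have hγμ : γ * μ ≤ 1 := by
    have h1 : 0 < γ * H * L := by positivity
    have h2 : γ * μ * 1 ≤ γ * μ * H := mul_le_mul_of_nonneg_left hH1 (mul_pos hγ hμ).le
    linarith [show γ * H * (L + μ) = γ * H * L + γ * μ * H by ring]
  set R : ℝ := (1 - γ * μ / 4) ^ H with hR
  have hρ0 : 0 < 1 - γ * μ / 4 := by linarith
  have hR0 : 0 < R := pow_pos hρ0 _
  have hR1 : R < 1 := pow_lt_one₀ hρ0.le (by linarith [mul_pos hγ hμ]) hH.ne'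
  have hd : ∀ c z, Differentiable ℝ (F c z) := fun c z => (h_smooth c z).1.1
  have hLip : ∀ c z θ θ', ‖gradient (F c z) θ - gradient (F c z) θ'‖ ≤ L * ‖θ - θ'‖ :=
    fun c z => (h_smooth c z).2
  have hgL2 : ∀ c θ, MemLp (fun z => gradient (F c z) θ) 2 (ν c) := by
    intro c θ
    obtain ⟨σ, β, -, -, hnoise⟩ := h_noise
    -- The case `p = 1` bounds the variance, hence gradients are square integrable.
    have h1 := hnoise θ c 1 (by simp)
    simp only [mul_one, Nat.cast_one, div_one, ENNReal.rpow_one] at h1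
    exact memLp_gradient (hF_meas c) (hd c) (h1.trans_lt ENNReal.ofReal_lt_top).ne
  have hg : ∀ c θ, Integrable (fun z => gradient (F c z) θ) (ν c) :=
    fun c θ => (hgL2 c θ).integrable one_le_two
  have hG := fun c => measurable_gradient_uncurry (hF_meas c) (hd c) (hLip c)
  have hup : Measurable (Function.uncurry (update F γ H : State N d → _ → _)) :=
    measurable_update hG
  have hupc : ∀ z, Continuous fun X : State N d => update F γ H X z :=
    continuous_update fun c z => continuous_gradient_of_lipschitz (hLip c z)
  let K : Kernel (State N d) (State N d) := ⟨transition F ν γ H, measurable_transition hup⟩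
  have hK : ∀ X, K X = transition F ν γ H X := fun X => rfl
  have hKmap : ∀ X, K X = (noiseLaw ν H).map (update F γ H X) := fun X => rfl
  have hKM : IsMarkovKernel K := ⟨fun X => by
    rw [hKmap]
    exact Measure.isProbabilityMeasure_map (hup.comp measurable_prodMk_left).aemeasurable⟩
  have hcontr : ∀ X Y : State N d, ∫⁻ z, ENNReal.ofReal (lambdaNormSq γ H
      ((update F γ H X z).1 - (update F γ H Y z).1)) ∂(noiseLaw ν H)
      ≤ ENNReal.ofReal R * ENNReal.ofReal (lambdaNormSq γ H (X.1 - Y.1)) := fun X Y =>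
    lintegral_lambdaNormSq_update_sub_le hN hH hL hμ hγ hγL' hγH hρ0.le hF_meas hF_int hd h_convex
      hLip hg (fun c => (h_strong c).2) X Y
  -- At the zero state `‖X - x₀‖_Λ` is `‖X‖_Λ`, so contraction towards its image becomes drift.
  let x₀ : State N d := ⟨0, by simp⟩
  obtain ⟨s, b, hs, hb, hdrift⟩ := exists_drift_of_contraction hup hR0 hR1 hcontr (x₀ := x₀) rfl
    (lintegral_lambdaNormSq_update_lt_top hG hLip (fun c => hgL2 c 0) x₀)
  obtain ⟨π, hπ, hinv, huniq, hmom⟩ := exists_invariant_of_contraction x₀ hup hupc hKmap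
    (measurable_ofReal_lambdaNormSq_sub γ H) (ENNReal.ofReal_lt_one.2 hR1) hcontr
    ENNReal.ofReal_ne_top (edist_sq_le_mul_lambdaNormSq hN hH hγ)
    (continuous_ofReal_lambdaNormSq γ H) (fun _ => ENNReal.ofReal_ne_top) hs hb hdrift
    (ofReal_lambdaNormSq_sub_le γ H)
  refine ⟨K, hKM, hK, fun P _ ρ ζ X hX => hX.isMarkovChain_and_map_eq hup hK, π, hπ, hinv, huniq,
    hmom, fun ρ hρ hρ2 => ?_⟩
  have hmoments := secondMoment_bind_pow_lt_top hup hKmap hs.ne_top hb hdrift hρ2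
  have hW := wassersteinSq_lt_top γ H hρ2 hmom
  have hrate : ∀ t : ℕ, wassersteinSq γ H (ρ.bind ⇑(K ^ t)) π
      ≤ ENNReal.ofReal R ^ t * wassersteinSq γ H ρ π := by
    intro t
    induction t with
    | zero => rw [bind_pow_zero, pow_zero, one_mul]
    | succ t ih =>
      have := (hmoments t).1
      have h1 := wassersteinSq_bind_le hup hKmap (ENNReal.ofReal_pos.2 hR0).ne'
        ENNReal.ofReal_ne_top hcontr (ρ.bind ⇑(K ^ t)) π
      -- Invariance keeps the second law equal to `π`, so each round contracts the distance to `π`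
      -- itself.
      rw [hinv.def, ← bind_pow_succ] at h1
      rw [pow_succ' (ENNReal.ofReal R), mul_assoc]
      exact h1.trans (mul_le_mul_right ih _)
  refine ⟨fun t => (hmoments t).2, hW, ?_, fun t => ?_⟩
  · have h1 : Tendsto (fun t : ℕ => ENNReal.ofReal R ^ t * wassersteinSq γ H ρ π) atTop (𝓝 0) := by
      have := ENNReal.Tendsto.mul_const (b := wassersteinSq γ H ρ π)
        (ENNReal.tendsto_pow_atTop_nhds_zero_of_lt_one (ENNReal.ofReal_lt_one.2 hR1))
        (Or.inr hW.ne)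
      rwa [zero_mul] at this
    exact tendsto_of_tendsto_of_tendsto_of_le_of_le tendsto_const_nhds h1 (fun _ => zero_le) hrate
  · rw [pow_mul, ENNReal.ofReal_pow hR0.le]
    exact hrate t
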